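/- **Setting.** Let $\gamma\in(0,1)$, $N:=\lfloor\gamma^{-1}\rfloor$, $d\ge 1$ and $T>0$. For $k\in\mathbb N^d$ put $|k|=\sum_i k_i$, $k!=\prod_i k_i!$, $\partial^k=\partial_1^{k_1}\cdots\partial_d^{k_d}$. Let $\mathbb A=\{k\in\mathbb N^d\setminus\{0\}: |k|\le N\}$, with canonical basis letters $e_1,\dots,e_d$, and with the bilinear bracket on $\mathbb R^{\mathbb A}$ given by $[k,l]=k+l$ if $|k+l|\le N$ and $[k,l]=0$ otherwise. Let $T(\mathbb A)$ be the real vector space spanned by the words in $\mathbb A$ ($\mathbf 1$ is the empty word), $\Vert k_1\cdots k_n\Vert=\sum_j|k_j|$ the weight of a word, $T^{\le M}$ the span of the words of weight at most $M$, $[\cdot]_{<M}$ the projection on the words of weight less than $M$, $\langle u^*,\cdot\rangle$ the coefficient of the word $u$. On $T(\mathbb A)$ consider the quasi-shuffle product, i.e. the bilinear product with unit $\mathbf 1$ and $va\star wb=(v\star wb)a+(va\star w)b+(v\star w)[a,b]$ for words $v,w$ and letters $a,b$, the deconcatenation coproduct $\nabla$, and the convolution $\langle\alpha*\beta,h\rangle=\langle\alpha\otimes\beta,\nabla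 h\rangle$ of functionals. A *$\gamma$-quasi-geometric rough path* is a map $\mathbb X:[0,T]^2\to (T^{\le N})^*$ such that, for all $s,u,t\in[0,T]$: $\langle\mathbb X_{st},\mathbf 1\rangle=1$; $\langle \mathbb X_{st},h\star k\rangle=\langle \mathbb X_{st},h\rangle\langle \mathbb X_{st},k\rangle$ whenever $h,k,h\star k\in T^{\le N}$; $\mathbb X_{su}*\mathbb X_{ut}=\mathbb X_{st}$; and $\sup_{s\ne t}|\langle\mathbb X_{st},w\rangle|/|t-s|^{\gamma\Vert w\Vert}<\infty$ for every word $w$ with $\Vert w\Vert\le N$. It is *over* $x:[0,T]\to\mathbb R^d$ if $\langle\mathbb X_{st},e_i\rangle=x^i_t-x^i_s$ for all $i,s,t$. For $1\le M\le N+1$, $\mathcal D^{M\gamma}_{\mathbb X}$ is the set of $Y:[0,T]\to T^{\le M-1}$ such that, for every word $u$ with $\Vert u\Vert\le M-1$, $t\mapsto\langle u^*,Y_t\rangle$ is $\gamma$-Hölder and $\sup_{s\neq t}|\langle u^*,Y_t\rangle-\langle\mathbb X_{st}*u^*,Y_s\rangle|/|t-s|^{(M-\Vert u\Vert)\gamma}<\infty$.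 For $k\in\mathbb A$ and $Y\in\mathcal D^{(N+1-|k|)\gamma}_{\mathbb X}$ the geometric rough integral is $$\int_0^tY_r\,d^g\mathbb X^k_r=\lim_{|\pi|\to0}\sum_{[s,u]\in\pi}\ \sum_{\Vert v\Vert\le N-|k|}\langle v^*,Y_s\rangle\langle\mathbb X_{su},vk\rangle ,$$ the limit being over all partitions $\pi$ of $[0,t]$ with mesh $|\pi|\to 0$, and $\int_s^t:=\int_0^t-\int_0^s$. For $\varphi:\mathbb R^d\to\mathbb R$, $X^i_r:=x^i_r\mathbf 1+e_i$ and $k\in\mathbb A$, with $M:=N+1-|k|$, set $$\partial^k\Phi(X_r):=\sum_{|l|<M}\frac{\partial^{l}(\partial^k\varphi)(x_r)}{l!}\,\big[e_1^{\star \,l_1}\,\star \cdots\star \,e_d^{\star \,l_d}\big]_{<M}.$$ **Theorem.** Let $x:[0,T]\to\mathbb R^d$ be $\gamma$-Hölder, let $\mathbb X$ be a $\gamma$-quasi-geometric rough path over $x$, and let $\varphi\in C^{N+1}_b(\mathbb R^d,\mathbb R)$, i.e. all partial derivatives of $\varphi$ of order at most $N+1$ (including $\varphi$ itself) are continuous and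 bounded. Then for every $k\in\mathbb A$ the path $r\mapsto\partial^k\Phi(X_r)$ belongs to $\mathcal D^{(N+1-|k|)\gamma}_{\mathbb X}$, the integrals $\int_0^t\partial^k\Phi(X_r)\,d^g\mathbb X^k_r$ exist for all $t\in[0,T]$, and for all $s,t\in[0,T]$ $$\varphi(x_t)=\varphi(x_s)+\sum_{n=1}^{N}\ \sum_{|k|=n}\frac1{k!}\int_s^t\partial^k\Phi(X_r)\,d^g\mathbb X^k_r .$$ -/

import Mathlib

open Set Filter Topology
open scoped BigOperators NNReal TensorProduct

/-! ### Words, deconcatenation and quasi-shuffle -/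

/-- `T(A)`: the free real vector space on the words with letters in `A`
(a word `a₁ ⋯ aₙ` is the list `[a₁, …, aₙ]`; the empty word is `[]`). -/
abbrev WordSpace (A : Type*) := List A →₀ ℝ

namespace WordSpace

variable {A : Type*}

/-- The basis vector of `T(A)` given by a word. -/
noncomputable def word (w : List A) : WordSpace A := Finsupp.single w 1

/-- The functional `u^*` of the basis dual to the words. -/
noncomputable def dualWord (u : List A) : Module.Dual ℝ (WordSpace A) := Finsupp.lapply u

/-- The linear map `w ↦ w a`, juxtaposition of a letter on the right. -/
noncomputable def append (a : A) : WordSpace A →ₗ[ℝ] WordSpace A :=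
  Finsupp.lmapDomain ℝ ℝ (fun w => w ++ [a])

/-- The bilinear extension of `(a, w) ↦ w a` to linear combinations of letters. -/
noncomputable def appendVec : (A →₀ ℝ) →ₗ[ℝ] WordSpace A →ₗ[ℝ] WordSpace A :=
  Finsupp.linearCombination ℝ append

/-- The deconcatenation coproduct
`a₁ ⋯ aₘ ↦ ∑_{0 ≤ i ≤ m} a₁ ⋯ aᵢ ⊗ aᵢ₊₁ ⋯ aₘ`. -/
noncomputable def deconcatenation : WordSpace A →ₗ[ℝ] WordSpace A ⊗[ℝ] WordSpace A :=
  Finsupp.linearCombination ℝ fun w =>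
    ∑ i ∈ Finset.range (w.length + 1), word (w.take i) ⊗ₜ[ℝ] word (w.drop i)

/-- The convolution product `⟨α * β, h⟩ = ⟨α ⊗ β, ∇ h⟩` of linear functionals. -/
noncomputable def convolution (α β : Module.Dual ℝ (WordSpace A)) :
    Module.Dual ℝ (WordSpace A) :=
  LinearMap.mul' ℝ ℝ ∘ₗ TensorProduct.map α β ∘ₗ deconcatenation

end WordSpace

/-- A commutative bracket on the alphabet `A`, i.e. a commutative and associative product on
`ℝ^A`, together with a grading of the letters by strictly positive integers which is respected
by the bracket. -/
structure GradedBracket (A : Type*) where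
  bracket : (A →₀ ℝ) →ₗ[ℝ] (A →₀ ℝ) →ₗ[ℝ] (A →₀ ℝ)
  bracket_comm : ∀ x y, bracket x y = bracket y x
  bracket_assoc : ∀ x y z, bracket (bracket x y) z = bracket x (bracket y z)
  letterWeight : A → ℕ
  letterWeight_pos : ∀ a, 0 < letterWeight a
  bracket_graded : ∀ a b c, bracket (Finsupp.single a 1) (Finsupp.single b 1) c ≠ 0 →
    letterWeight c = letterWeight a + letterWeight b

namespace GradedBracket

open WordSpace

variable {A : Type*} (B : GradedBracket A)

/-- The intrinsic weight of a word: the sum of the weights of its letters. -/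
def weight (w : List A) : ℕ := (w.map B.letterWeight).sum

/-- The span of the words of intrinsic weight at most `N`. -/
noncomputable def truncated (N : ℕ) : Submodule ℝ (WordSpace A) :=
  Finsupp.supported ℝ ℝ {w | B.weight w ≤ N}

/-- The projection `[·]_{<N}` on the span of the words of intrinsic weight less than `N`. -/
noncomputable def projLT (N : ℕ) (h : WordSpace A) : WordSpace A :=
  h.filter (fun w => B.weight w < N)

/-- Auxiliary recursion for the quasi-shuffle of two words: the two arguments are the words
read from the last letter to the first, the value is written in the usual order. -/
noncomputable def quasiShuffleRev : List A → List A → WordSpace A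
  | [], w => word w.reverse
  | a :: v, [] => word (a :: v).reverse
  | a :: v, b :: w =>
      append a (quasiShuffleRev v (b :: w)) + append b (quasiShuffleRev (a :: v) w)
        + appendVec (B.bracket (Finsupp.single a 1) (Finsupp.single b 1)) (quasiShuffleRev v w)
  termination_by v w => v.length + w.length

/-- The quasi-shuffle product of two words. -/
noncomputable def quasiShuffleWord (v w : List A) : WordSpace A :=
  B.quasiShuffleRev v.reverse w.reverse

theorem quasiShuffleWord_nil_left (w : List A) : B.quasiShuffleWord [] w = word w := by
  simp [quasiShuffleWord, quasiShuffleRev]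

theorem quasiShuffleWord_nil_right (v : List A) : B.quasiShuffleWord v [] = word v := by
  rcases h : v.reverse with _ | ⟨a, u⟩
  · simp [quasiShuffleWord, quasiShuffleRev, List.reverse_eq_nil_iff.mp h]
  · have : v = (a :: u).reverse := by rw [← h, List.reverse_reverse]
    simp [quasiShuffleWord, quasiShuffleRev, this]

/-- The recursive identity `va ⧢ wb = (v ⧢ wb) a + (va ⧢ w) b + (v ⧢ w) [ab]` which, with
the two preceding identities, characterises the quasi-shuffle product. -/
theorem quasiShuffleWord_append (v w : List A) (a b : A) :
    B.quasiShuffleWord (v ++ [a]) (w ++ [b]) =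
      append a (B.quasiShuffleWord v (w ++ [b])) + append b (B.quasiShuffleWord (v ++ [a]) w)
        + appendVec (B.bracket (Finsupp.single a 1) (Finsupp.single b 1))
            (B.quasiShuffleWord v w) := by
  simp [quasiShuffleWord, quasiShuffleRev]

/-- The quasi-shuffle product on `T(A)`. -/
noncomputable def quasiShuffle : WordSpace A →ₗ[ℝ] WordSpace A →ₗ[ℝ] WordSpace A :=
  Finsupp.linearCombination ℝ fun v =>
    Finsupp.linearCombination ℝ fun w => B.quasiShuffleWord v w

/-- The monomial `a₁^{k₁} ⋯ aₑ^{kₑ}` for the quasi-shuffle product. -/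
noncomputable def monomial {e : ℕ} (a : Fin e → WordSpace A) (k : Fin e → ℕ) : WordSpace A :=
  ((List.finRange e).flatMap fun i => List.replicate (k i) (a i)).foldr
    (fun y z => B.quasiShuffle y z) (word [])

end GradedBracket

/-! ### Partial derivatives and the classes `C_b^n` -/

/-- The partial derivative `∂_i f`. -/
noncomputable def partialDeriv {d : ℕ} (i : Fin d) (f : EuclideanSpace ℝ (Fin d) → ℝ) :
    EuclideanSpace ℝ (Fin d) → ℝ :=
  fun y => lineDeriv ℝ f y (EuclideanSpace.single i 1)

/-- `∂^k f = ∂_1^{k_1} ⋯ ∂_d^{k_d} f`. -/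
noncomputable def multiDeriv {d : ℕ} (k : Fin d → ℕ) (f : EuclideanSpace ℝ (Fin d) → ℝ) :
    EuclideanSpace ℝ (Fin d) → ℝ :=
  (List.finRange d).foldr (fun i g => (partialDeriv i)^[k i] g) f

/-- `k! = k_1! ⋯ k_d!`. -/
def multiFactorial {d : ℕ} (k : Fin d → ℕ) : ℕ := ∏ i, (k i).factorial

/-- `C_b^n`: all partial derivatives of order at most `n` are continuous and bounded. -/
def IsCb {d : ℕ} (n : ℕ) (f : EuclideanSpace ℝ (Fin d) → ℝ) : Prop :=
  ContDiff ℝ n f ∧ ∀ k : Fin d → ℕ, ∑ i, k i ≤ n → ∃ C : ℝ, ∀ y, |multiDeriv k f y| ≤ C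

/-! ### Rough paths, controlled paths, lifting of functions, rough integrals -/

/-- `f` is `γ`-Hölder on `[0,T]`. -/
def IsHolder {E : Type*} [PseudoEMetricSpace E] (γ T : ℝ) (f : ℝ → E) : Prop :=
  ∃ C : ℝ≥0, HolderOnWith C γ.toNNReal f (Icc 0 T)

/-- `N_γ = ⌊γ⁻¹⌋`. -/
noncomputable def roughLevel (γ : ℝ) : ℕ := ⌊γ⁻¹⌋₊

theorem one_le_roughLevel {γ : ℝ} (hγ : γ ∈ Ioo (0 : ℝ) 1) : 1 ≤ roughLevel γ := by
  rw [roughLevel, Nat.one_le_floor_iff]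
  exact (one_le_inv₀ hγ.1).mpr hγ.2.le

namespace GradedBracket

open WordSpace

variable {A : Type*} (B : GradedBracket A)

/-- `γ`-quasi-geometric rough paths on `[0,T]`. An element of the dual of the truncated space
(words of weight at most `N_γ`) is represented by a linear functional on `T(A)` extending it:
only its values on the truncated space enter in the conditions. The first condition says that
the truncated characters `X s t` are non-zero. -/
structure IsQuasiGeometricRoughPath (γ T : ℝ) (X : ℝ → ℝ → Module.Dual ℝ (WordSpace A)) :
    Prop where
  unit : ∀ s ∈ Icc 0 T, ∀ t ∈ Icc 0 T, X s t (word []) = 1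
  mul : ∀ s ∈ Icc 0 T, ∀ t ∈ Icc 0 T,
    ∀ h ∈ B.truncated (roughLevel γ), ∀ k ∈ B.truncated (roughLevel γ),
      B.quasiShuffle h k ∈ B.truncated (roughLevel γ) →
        X s t (B.quasiShuffle h k) = X s t h * X s t k
  chen : ∀ s ∈ Icc 0 T, ∀ u ∈ Icc 0 T, ∀ t ∈ Icc 0 T,
    ∀ h ∈ B.truncated (roughLevel γ), convolution (X s u) (X u t) h = X s t h
  bound : ∀ w : List A, B.weight w ≤ roughLevel γ → ∃ C : ℝ,
    ∀ s ∈ Icc 0 T, ∀ t ∈ Icc 0 T, s ≠ t →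
      |X s t (word w)| ≤ C * |t - s| ^ (γ * (B.weight w : ℝ))

/-- `Y` belongs to the space `𝒟_X^{Nγ}` of weighted controlled rough paths
(`1 ≤ N ≤ N_γ + 1`). -/
structure IsControlled (γ T : ℝ) (X : ℝ → ℝ → Module.Dual ℝ (WordSpace A)) (N : ℕ)
    (Y : ℝ → WordSpace A) : Prop where
  mem : ∀ t ∈ Icc 0 T, ∀ u : List A, N ≤ B.weight u → dualWord u (Y t) = 0
  holder : ∀ u : List A, B.weight u < N → IsHolder γ T (fun t => dualWord u (Y t))
  remainder : ∀ u : List A, B.weight u < N → ∃ C : ℝ,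
    ∀ s ∈ Icc 0 T, ∀ t ∈ Icc 0 T, s ≠ t →
      |dualWord u (Y t) - convolution (X s t) (dualWord u) (Y s)|
        ≤ C * |t - s| ^ (((N : ℝ) - (B.weight u : ℝ)) * γ)

/-- The lifting
`Φ(a) = ∑_{|k| < N} ∂^k φ(⟨1^*, a⟩) / k! · [(a⁺)_1^{k_1} ⋯ (a⁺)_e^{k_e}]_{<N}`
of `φ`, where `a⁺ = a - ⟨1^*, a⟩ 1` (the terms with `|k| ≥ N` would be zero). -/
noncomputable def lift (N : ℕ) {e : ℕ} (φ : EuclideanSpace ℝ (Fin e) → ℝ)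
    (a : Fin e → WordSpace A) : WordSpace A :=
  ∑ n ∈ Finset.range N, ∑ k ∈ Finset.piAntidiag (Finset.univ : Finset (Fin e)) n,
    (multiDeriv k φ (WithLp.toLp 2 fun i => dualWord [] (a i)) / (multiFactorial k : ℝ)) •
      B.projLT N (B.monomial (fun i => a i - dualWord [] (a i) • word []) k)

end GradedBracket

/-- A partition `a = p_0 < p_1 < ⋯ < p_n = b` of `[a,b]`. -/
structure IntervalPartition (a b : ℝ) where
  n : ℕ
  pts : Fin (n + 1) → ℝ
  strictMono_pts : StrictMono pts
  first : pts 0 = a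
  last : pts (Fin.last n) = b

namespace IntervalPartition

variable {a b : ℝ}

/-- The mesh of a partition. -/
noncomputable def mesh (π : IntervalPartition a b) : ℝ :=
  ⨆ i : Fin π.n, (π.pts i.succ - π.pts i.castSucc)

/-- The sum over the intervals `[s,u]` of the partition of `Z s u`. -/
noncomputable def sum (π : IntervalPartition a b) (Z : ℝ → ℝ → ℝ) : ℝ :=
  ∑ i : Fin π.n, Z (π.pts i.castSucc) (π.pts i.succ)

/-- The filter `|π| → 0` on the partitions of `[a,b]`. -/
noncomputable def meshToZero (a b : ℝ) : Filter (IntervalPartition a b) :=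
  comap mesh (𝓝 0)

end IntervalPartition

namespace GradedBracket

open WordSpace

variable {A : Type*} (B : GradedBracket A)

/-- The germ `∑_{ω(v) ≤ N_γ - ω(a)} ⟨v^*, Y_s⟩ ⟨X_{su}, v a⟩` of the geometric rough integral
against the letter `a`. -/
noncomputable def integralGerm (γ : ℝ) (X : ℝ → ℝ → Module.Dual ℝ (WordSpace A))
    (Y : ℝ → WordSpace A) (a : A) (s u : ℝ) : ℝ :=
  ((Y s).filter fun v => B.weight v + B.letterWeight a ≤ roughLevel γ).sum
    fun v c => c * X s u (word (v ++ [a]))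

/-- `I` is the geometric rough integral `∫_0^t Y_r d^g X^a_r`, i.e. the limit of the Riemann type
sums over all partitions of `[0,t]` whose mesh tends to zero. -/
def HasGeomRoughIntegral (γ : ℝ) (X : ℝ → ℝ → Module.Dual ℝ (WordSpace A))
    (Y : ℝ → WordSpace A) (a : A) (t I : ℝ) : Prop :=
  Tendsto (fun π : IntervalPartition 0 t => π.sum (B.integralGerm γ X Y a))
    (IntervalPartition.meshToZero 0 t) (𝓝 I)

end GradedBracket

/-! ### The alphabet of multi-indices -/

/-- The alphabet of the non-zero multi-indices `α ∈ ℕ^d` with `|α| ≤ N`. -/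
abbrev MultiIndexLetter (d N : ℕ) := {α : Fin d → ℕ // α ≠ 0 ∧ ∑ i, α i ≤ N}

namespace MultiIndexLetter

variable {d N : ℕ}

instance : Finite (MultiIndexLetter d N) := by
  have h : Set.Finite {α : Fin d → ℕ | α ≠ 0 ∧ ∑ i, α i ≤ N} := by
    refine (Set.Finite.pi' fun _ : Fin d => Set.finite_Iic N).subset ?_
    intro α hα i
    exact (Finset.single_le_sum (fun j _ => Nat.zero_le (α j)) (Finset.mem_univ i)).trans hα.2
  exact h.to_subtype

noncomputable instance : Fintype (MultiIndexLetter d N) := Fintype.ofFinite _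

/-- `|α| = α_1 + ⋯ + α_d`. -/
def degree (α : MultiIndexLetter d N) : ℕ := ∑ i, α.1 i

theorem degree_pos (α : MultiIndexLetter d N) : 0 < α.degree := by
  rw [Nat.pos_iff_ne_zero]
  intro h
  apply α.2.1
  funext i
  exact Finset.sum_eq_zero_iff.mp h i (Finset.mem_univ i)

theorem sum_add_degree (α β : MultiIndexLetter d N) :
    ∑ i, (α.1 + β.1) i = α.degree + β.degree := by
  simp [degree, Finset.sum_add_distrib]

/-- The sum `α + β` of two letters whose total degree does not exceed `N`. -/
def add (α β : MultiIndexLetter d N) (h : α.degree + β.degree ≤ N) : MultiIndexLetter d N :=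
  ⟨α.1 + β.1, fun h0 => by
      have h1 := sum_add_degree α β
      have h2 := α.degree_pos
      rw [h0] at h1
      simp at h1
      omega,
    (sum_add_degree α β).trans_le h⟩

theorem degree_add (α β : MultiIndexLetter d N) (h : α.degree + β.degree ≤ N) :
    (add α β h).degree = α.degree + β.degree := sum_add_degree α β

/-- The letter `e_i`, the `i`-th element of the canonical basis. -/
def basis (hN : 1 ≤ N) (i : Fin d) : MultiIndexLetter d N :=
  ⟨Pi.single i 1, by simp, by simpa using hN⟩

/-- `[α, β] = α + β` if this is again a letter, and `0` otherwise. -/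
noncomputable def letterBracket (α β : MultiIndexLetter d N) : MultiIndexLetter d N →₀ ℝ :=
  if h : α.degree + β.degree ≤ N then Finsupp.single (add α β h) 1 else 0

/-- The bilinear extension of the bracket of letters. -/
noncomputable def bilinBracket : (MultiIndexLetter d N →₀ ℝ) →ₗ[ℝ]
    (MultiIndexLetter d N →₀ ℝ) →ₗ[ℝ] (MultiIndexLetter d N →₀ ℝ) :=
  Finsupp.linearCombination ℝ fun α =>
    Finsupp.linearCombination ℝ fun β => letterBracket α β

theorem bilinBracket_single (α β : MultiIndexLetter d N) :
    bilinBracket (Finsupp.single α 1) (Finsupp.single β 1) = letterBracket α β := by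
  simp [bilinBracket]

theorem letterBracket_comm (α β : MultiIndexLetter d N) :
    letterBracket α β = letterBracket β α := by
  unfold letterBracket
  by_cases h : α.degree + β.degree ≤ N
  · have h' : β.degree + α.degree ≤ N := by omega
    rw [dif_pos h, dif_pos h']
    congr 1
    exact Subtype.ext (add_comm _ _)
  · have h' : ¬ β.degree + α.degree ≤ N := by omega
    rw [dif_neg h, dif_neg h']

theorem bilinBracket_assoc_single (α β δ : MultiIndexLetter d N) :
    bilinBracket (letterBracket α β) (Finsupp.single δ 1) =
      bilinBracket (Finsupp.single α 1) (letterBracket β δ) := by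
  by_cases h : α.degree + β.degree + δ.degree ≤ N
  · have h1 : α.degree + β.degree ≤ N := by omega
    have h2 : β.degree + δ.degree ≤ N := by omega
    rw [letterBracket, dif_pos h1, letterBracket, dif_pos h2, bilinBracket_single,
      bilinBracket_single, letterBracket, letterBracket, dif_pos (by rw [degree_add]; omega),
      dif_pos (by rw [degree_add]; omega)]
    congr 1
    exact Subtype.ext (add_assoc _ _ _)
  · have hl : bilinBracket (letterBracket α β) (Finsupp.single δ 1) = 0 := by
      unfold letterBracket
      split_ifs with h1
      · rw [bilinBracket_single, letterBracket, dif_neg (by rw [degree_add]; omega)]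
      · simp
    have hr : bilinBracket (Finsupp.single α 1) (letterBracket β δ) = 0 := by
      unfold letterBracket
      split_ifs with h1
      · rw [bilinBracket_single, letterBracket, dif_neg (by rw [degree_add]; omega)]
      · simp
    rw [hl, hr]

/-- The commutative bracket `[·,·]_γ` on the alphabet of multi-indices, with `N = N_γ`, graded by
the degree of the multi-indices. -/
noncomputable def gradedBracket (d N : ℕ) : GradedBracket (MultiIndexLetter d N) where
  bracket := bilinBracket
  bracket_comm x y := by
    have h : (bilinBracket : (MultiIndexLetter d N →₀ ℝ) →ₗ[ℝ] _) = bilinBracket.flip := by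
      ext α β : 4
      simpa [bilinBracket] using letterBracket_comm α β
    exact congrArg (fun f => f x y) h
  bracket_assoc x y z := by
    induction x using Finsupp.induction_linear with
    | zero => simp
    | add x x' hx hx' => simp [hx, hx']
    | single α r =>
      induction y using Finsupp.induction_linear with
      | zero => simp
      | add y y' hy hy' => simp [hy, hy']
      | single β r' =>
        induction z using Finsupp.induction_linear with
        | zero => simp
        | add z z' hz hz' => simp [hz, hz']
        | single δ r'' =>
          have h1 (ε : MultiIndexLetter d N) (q : ℝ) :
              Finsupp.single ε q = q • Finsupp.single ε 1 := by simp
          rw [h1 α, h1 β, h1 δ]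
          simp only [map_smul, LinearMap.smul_apply, bilinBracket_single,
            bilinBracket_assoc_single]
  letterWeight := degree
  letterWeight_pos := degree_pos
  bracket_graded α β δ h := by
    rw [bilinBracket_single, letterBracket] at h
    split_ifs at h with h1
    · by_cases h2 : add α β h1 = δ
      · rw [← h2, degree_add]
      · simp [h2] at h
    · simp at h

end MultiIndexLetter

/-- The `d`-tuple of paths `X^i_t = x^i_t 1 + e_i` with values in `T(A)`. -/
noncomputable def coordinateLift {d N : ℕ} (hN : 1 ≤ N)
    (x : ℝ → EuclideanSpace ℝ (Fin d)) (t : ℝ) (i : Fin d) :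
    WordSpace (MultiIndexLetter d N) :=
  x t i • WordSpace.word [] + WordSpace.word [MultiIndexLetter.basis hN i]

/-- The path `r ↦ ∂^k Φ(X_r)`: the lifting, at the level `N_γ + 1 - |k|`, of `∂^k φ` evaluated at
the coordinate path. -/
noncomputable def derivLift {d : ℕ} {γ : ℝ} (hγ : γ ∈ Ioo (0 : ℝ) 1)
    (x : ℝ → EuclideanSpace ℝ (Fin d)) (φ : EuclideanSpace ℝ (Fin d) → ℝ)
    (k : MultiIndexLetter d (roughLevel γ)) (r : ℝ) :
    WordSpace (MultiIndexLetter d (roughLevel γ)) :=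
  (MultiIndexLetter.gradedBracket d (roughLevel γ)).lift (roughLevel γ + 1 - k.degree)
    (multiDeriv k.1 φ) (coordinateLift (one_le_roughLevel hγ) x r)

/-!
The coefficients of the lifted derivative are explicit. For a word `w` let `Σ w` be the sum of
its letters and `w!` the product of their factorials. An induction on words gives
`e_1^{⋆ l_1} ⋆ ⋯ ⋆ e_d^{⋆ l_d} = ∑_{Σ w = l} (l! / w!) w` (`basisProduct_apply`), so that
`∂^k Φ(X_r) = ∑_w ∂^{k + Σ w} φ(x_r) / w! · w`, the sum being over the words of weight at most
`N - |k|` (`derivLift_apply`). Evaluating the rough path, which is multiplicative, on the same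
quasi-shuffle powers gives `∑_{Σ w = l} 𝕏_{st}(w) / w! = (x_t - x_s)^l / l!`
(`sum_wordSum_eq`). With these two facts the remainder of `∂^k Φ(X)` at a word `u` becomes
`1 / u!` times the Taylor remainder of `∂^{k + Σ u} φ` between `x_s` and `x_t`, of order
`N + 1 - |k| - ‖u‖`, and Taylor's formula shows that `∂^k Φ(X)` is controlled
(`isControlled_derivLift`).

By Chen's relation, the germ of the rough integral of a controlled path is additive up to
`O(|t - s|^{(N + 1) γ})`, with `(N + 1) γ > 1` (`IsControlled.exists_isAlmostAdditive`). The sewing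
lemma (`IsAlmostAdditive.exists_sewing`) then provides the integrals.

Finally, every nonempty word is uniquely of the form `v k`, so the sum over `k` of the germs of
`∫ ∂^k Φ(X) d𝕏^k`, weighted by `1 / k!`, is the Taylor polynomial of order `N` of `φ` at `x_s`
without its constant term (`sum_integralGerm_derivLift`). It differs from `φ(x_t) - φ(x_s)` by
`O(|t - s|^{(N + 1) γ})`, so its Riemann sums converge to the increment of `φ(x)`.
-/

/-! ### Sewing -/

/-- A germ `Ξ` on `[0,T]` whose defect of additivity is at most `C |t - s|^θ`. -/
def IsAlmostAdditive (T C θ : ℝ) (Ξ : ℝ → ℝ → ℝ) : Prop :=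
  ∀ s u t, 0 ≤ s → s ≤ u → u ≤ t → t ≤ T → |Ξ s t - Ξ s u - Ξ u t| ≤ C * (t - s) ^ θ

namespace IsAlmostAdditive

variable {T C θ : ℝ} {Ξ : ℝ → ℝ → ℝ}

theorem diag (h : IsAlmostAdditive T C θ Ξ) (hθ : 1 < θ) {s : ℝ} (h0 : 0 ≤ s) (hT : s ≤ T) :
    Ξ s s = 0 := by
  have := h s s s h0 le_rfl le_rfl hT
  rw [sub_self s, Real.zero_rpow (by linarith), mul_zero] at this
  have := abs_nonpos_iff.mp this
  linarith

/-- The sewing estimate: `Ξ` differs from its Riemann sums by at most `K |b - a|^θ`, whatever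
the partition of `[a,b]`. The partition is cut at the interval that contains the midpoint, and
both remaining pieces are at most half as long, so that the constant `K` reproduces itself. -/
theorem chain_bound (h : IsAlmostAdditive T C θ Ξ) (hθ : 1 < θ) (hC : 0 ≤ C)
    {p : ℕ → ℝ} (hp : Monotone p) (h0 : ∀ i, 0 ≤ p i) (hT : ∀ i, p i ≤ T) (m n : ℕ) (hmn : m ≤ n) :
    |Ξ (p m) (p n) - ∑ i ∈ Finset.Ico m n, Ξ (p i) (p (i + 1))|
      ≤ 2 * C / (1 - 2 ^ (1 - θ)) * (p n - p m) ^ θ := by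
  set K : ℝ := 2 * C / (1 - 2 ^ (1 - θ)) with hK
  have h2 : (2 : ℝ) ^ (1 - θ) < 1 := Real.rpow_lt_one_of_one_lt_of_neg one_lt_two (by linarith)
  have hK0 : 0 ≤ K := div_nonneg (by positivity) (by linarith)
  have hKeq : K * 2 ^ (1 - θ) + 2 * C = K := by
    have : K * (1 - 2 ^ (1 - θ)) = 2 * C := div_mul_cancel₀ _ (by linarith)
    linarith
  induction hk : n - m using Nat.strong_induction_on generalizing m n with
  | _ k ih =>
    rcases hmn.eq_or_lt with rfl | hlt
    · simp [h.diag hθ (h0 m) (hT m), Real.zero_rpow (by linarith : θ ≠ 0)]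
    set Λ := p n - p m with hΛ
    have hΛ0 : 0 ≤ Λ := sub_nonneg.mpr (hp hmn)
    -- `j + 1` is the first index whose point lies beyond the midpoint, or `n` if there is none.
    obtain ⟨j, hmj, hjn, hj1, hj2⟩ : ∃ j, m ≤ j ∧ j < n ∧ p j - p m ≤ Λ / 2 ∧
        p n - p (j + 1) ≤ Λ / 2 := by
      let P : ℕ → Prop := fun i => m < i ∧ (i = n ∨ Λ / 2 < p i - p m)
      have hP : ∃ i, P i := ⟨n, hlt, Or.inl rfl⟩
      classical
      have hs := Nat.find_spec hP
      have hle : Nat.find hP ≤ n := Nat.find_min' hP ⟨hlt, Or.inl rfl⟩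
      set q := Nat.find hP with hq
      have hq1 : m < q := hs.1
      refine ⟨q - 1, by omega, by omega, ?_, ?_⟩
      · have := Nat.find_min hP (m := q - 1) (by omega)
        by_cases hqm : q - 1 = m
        · rw [hqm]; simp; linarith
        · by_contra hcon
          exact this ⟨by omega, Or.inr (not_le.mp hcon)⟩
      · rw [Nat.sub_add_cancel (by omega)]
        rcases hs.2 with h1 | h1
        · rw [h1]; simp; linarith
        · linarith
    have i1 := ih (j - m) (by omega) m j hmj rfl
    have i2 := ih (n - (j + 1)) (by omega) (j + 1) n hjn rfl
    have hhalf : ∀ y, 0 ≤ y → y ≤ Λ / 2 → K * y ^ θ ≤ K * (2 ^ (1 - θ) * Λ ^ θ / 2) := by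
      intro y hy hy2
      refine mul_le_mul_of_nonneg_left ?_ hK0
      refine (Real.rpow_le_rpow hy hy2 (by linarith)).trans_eq ?_
      rw [Real.div_rpow hΛ0 zero_le_two, Real.rpow_sub two_pos, Real.rpow_one]
      field_simp
    have e1 := hhalf _ (sub_nonneg.mpr (hp hmj)) hj1
    have e2 := hhalf _ (sub_nonneg.mpr (hp (Nat.succ_le_of_lt hjn))) hj2
    have d1 := h (p m) (p j) (p n) (h0 m) (hp hmj) (hp hjn.le) (hT n)
    have d2 := h (p j) (p (j + 1)) (p n) (h0 j) (hp j.le_succ) (hp hjn) (hT n)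
    have d2' : C * (p n - p j) ^ θ ≤ C * Λ ^ θ := by
      refine mul_le_mul_of_nonneg_left (Real.rpow_le_rpow (sub_nonneg.mpr (hp hjn.le)) ?_
        (by linarith)) hC
      have := hp hmj
      linarith
    have hsum : ∑ i ∈ Finset.Ico m n, Ξ (p i) (p (i + 1)) =
        ∑ i ∈ Finset.Ico m j, Ξ (p i) (p (i + 1)) + Ξ (p j) (p (j + 1))
          + ∑ i ∈ Finset.Ico (j + 1) n, Ξ (p i) (p (i + 1)) := by
      rw [← Finset.sum_Ico_consecutive _ hmj hjn.le, Finset.sum_eq_sum_Ico_succ_bot hjn]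
      ring
    rw [hsum]
    have : K * Λ ^ θ = 2 * (K * (2 ^ (1 - θ) * Λ ^ θ / 2)) + 2 * (C * Λ ^ θ) := by
      linear_combination (-Λ ^ θ) * hKeq
    rw [this]
    rw [abs_le] at *
    constructor <;> linarith [i1.1, i1.2, i2.1, i2.2, d1.1, d1.2, d2.1, d2.2]

/-- The Riemann sum of `Ξ` on `[0,t]` along the points `i T / n`, stopped at `t`. -/
noncomputable def stoppedSum (T : ℝ) (Ξ : ℝ → ℝ → ℝ) (n : ℕ) (t : ℝ) : ℝ :=
  ∑ i ∈ Finset.range n, Ξ (min (i * (T / n)) t) (min ((i + 1 : ℕ) * (T / n)) t)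

theorem sum_rpow_le {ι : Type*} (S : Finset ι) (g : ι → ℝ) (hg : ∀ i ∈ S, 0 ≤ g i) {θ M : ℝ}
    (hθ : 1 < θ) (hM : ∀ i ∈ S, g i ≤ M) : ∑ i ∈ S, g i ^ θ ≤ M ^ (θ - 1) * ∑ i ∈ S, g i := by
  rw [Finset.mul_sum]
  refine Finset.sum_le_sum fun i hi => ?_
  have h1 : g i ^ θ = g i ^ (θ - 1) * g i := by
    rcases (hg i hi).eq_or_lt with h | h
    · rw [← h, Real.zero_rpow (by linarith), mul_zero]
    · rw [← Real.rpow_add_one h.ne', sub_add_cancel]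
  rw [h1]
  exact mul_le_mul_of_nonneg_right (Real.rpow_le_rpow (hg i hi) (hM i hi) (by linarith)) (hg i hi)

/-- Stopped Riemann sums are additive up to an error that vanishes with the mesh, since `s`
refines a single interval of the partition. -/
theorem stoppedSum_sub_le (h : IsAlmostAdditive T C θ Ξ) (hθ : 1 < θ) (hC : 0 ≤ C)
    {s t : ℝ} (hs : 0 ≤ s) (hst : s ≤ t) (htT : t ≤ T) {n : ℕ} (hn : 0 < n) :
    |stoppedSum T Ξ n t - stoppedSum T Ξ n s - Ξ s t| ≤
      2 * C / (1 - 2 ^ (1 - θ)) * (t - s) ^ θ + C * ((T / n) ^ (θ - 1) * T) := by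
  have hn' : (0 : ℝ) < n := Nat.cast_pos.mpr hn
  have hT0 : 0 ≤ T := hs.trans (hst.trans htT)
  have hδ : 0 ≤ T / n := by positivity
  set r : ℕ → ℝ := fun i => i * (T / n) with hr
  have hr0 : ∀ i, 0 ≤ r i := fun i => by positivity
  have hrm : Monotone r := fun i j hij => by
    simp only [hr]; gcongr
  set q : ℕ → ℝ := fun i => max s (min (r i) t) with hq
  have hqm : Monotone q := fun i j hij => by
    simp only [hq]; have := hrm hij; gcongr
  have hchain := h.chain_bound hθ hC hqm (fun i => hs.trans (le_max_left _ _))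
    (fun i => max_le (hst.trans htT) ((min_le_right _ _).trans htT)) 0 n n.zero_le
  have hq0 : q 0 = s := by simp [hq, hr, hs, hs.trans hst]
  have hqn : q n = t := by
    have : r n = T := by simp only [hr]; field_simp
    simp [hq, this, htT, hst]
  rw [hq0, hqn, ← Finset.range_eq_Ico] at hchain
  -- Unless `s` lies inside the `i`-th interval, the three terms cancel, one of the intervals being
  -- degenerate.
  have hstep : ∀ i, |Ξ (min (r i) t) (min (r (i + 1)) t) - Ξ (min (r i) s) (min (r (i + 1)) s)
      - Ξ (q i) (q (i + 1))| ≤ C * (r (i + 1) - r i) ^ θ := by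
    intro i
    have hle := hrm i.le_succ
    have hpos : 0 ≤ C * (r (i + 1) - r i) ^ θ :=
      mul_nonneg hC (Real.rpow_nonneg (sub_nonneg.mpr hle) _)
    have hd := h.diag hθ hs (hst.trans htT)
    rcases le_total (r (i + 1)) s with h1 | h1
    · have h2 := hle.trans h1
      simp only [hq]
      rw [min_eq_left (h1.trans hst), min_eq_left (h2.trans hst), min_eq_left h1, min_eq_left h2,
        max_eq_left h1, max_eq_left h2, hd]
      simpa using hpos
    · rcases le_total s (r i) with h2 | h2
      · simp only [hq]
        rw [min_eq_right h1, min_eq_right h2, max_eq_right (le_min h2 hst),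
          max_eq_right (le_min h1 hst), hd]
        simpa using hpos
      · simp only [hq]
        rw [min_eq_right h1, min_eq_left (h2.trans hst), min_eq_left h2, max_eq_left h2,
          max_eq_right (le_min h1 hst)]
        refine (h _ s _ (hr0 i) h2 (le_min h1 hst) ((min_le_right _ _).trans htT)).trans ?_
        refine mul_le_mul_of_nonneg_left (Real.rpow_le_rpow ?_ ?_ (by linarith)) hC
        · linarith [le_min h1 hst]
        · linarith [min_le_left (r (i + 1)) t]
  have hsum : |∑ i ∈ Finset.range n, (Ξ (min (r i) t) (min (r (i + 1)) t)
      - Ξ (min (r i) s) (min (r (i + 1)) s) - Ξ (q i) (q (i + 1)))|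
        ≤ C * ((T / n) ^ (θ - 1) * T) := by
    refine (Finset.abs_sum_le_sum_abs _ _).trans ((Finset.sum_le_sum fun i _ => hstep i).trans ?_)
    rw [← Finset.mul_sum]
    refine mul_le_mul_of_nonneg_left ?_ hC
    refine (sum_rpow_le _ (fun i => r (i + 1) - r i)
      (fun i _ => sub_nonneg.mpr (hrm i.le_succ)) hθ (M := T / n) fun i _ => ?_).trans_eq ?_
    · simp only [hr]; push_cast; linarith
    · rw [Finset.sum_range_sub]
      have hrn : r n = T := by simp only [hr]; field_simp
      have hr0' : r 0 = 0 := by simp [hr]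
      rw [hrn, hr0', sub_zero]
  rw [Finset.sum_sub_distrib, Finset.sum_sub_distrib] at hsum
  change |∑ i ∈ Finset.range n, Ξ (min (r i) t) (min (r (i + 1)) t) -
    ∑ i ∈ Finset.range n, Ξ (min (r i) s) (min (r (i + 1)) s) - Ξ s t| ≤ _
  rw [abs_le] at *
  constructor <;> linarith [hchain.1, hchain.2, hsum.1, hsum.2]

/-- The sewing lemma: an almost additive germ is, up to `O(|t - s|^θ)`, the increment of a
function. The function is a limit of stopped Riemann sums along an ultrafilter; the convergence
of the sums themselves is not needed. -/
theorem exists_sewing (h : IsAlmostAdditive T C θ Ξ) (hθ : 1 < θ) (hC : 0 ≤ C) (hT : 0 ≤ T) :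
    ∃ (F : ℝ → ℝ) (K : ℝ), 0 ≤ K ∧
      ∀ s t, 0 ≤ s → s ≤ t → t ≤ T → |F t - F s - Ξ s t| ≤ K * (t - s) ^ θ := by
  set K : ℝ := 2 * C / (1 - 2 ^ (1 - θ)) with hK
  have h2 : (2 : ℝ) ^ (1 - θ) < 1 := Real.rpow_lt_one_of_one_lt_of_neg one_lt_two (by linarith)
  have hK0 : 0 ≤ K := div_nonneg (by positivity) (by linarith)
  have herr : Tendsto (fun n : ℕ => C * ((T / n) ^ (θ - 1) * T)) atTop (𝓝 0) := by
    have h1 : Tendsto (fun n : ℕ => T / n) atTop (𝓝 0) := tendsto_const_div_atTop_nhds_zero_nat T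
    have h3 := h1.rpow_const (p := θ - 1) (Or.inr (by linarith))
    rw [Real.zero_rpow (by linarith)] at h3
    simpa using (h3.mul_const T).const_mul C
  let 𝒰 : Ultrafilter ℕ := Filter.hyperfilter ℕ
  have h𝒰 : (𝒰 : Filter ℕ) ≤ atTop := Nat.hyperfilter_le_atTop
  have hbdd : ∀ t, 0 ≤ t → t ≤ T → ∃ y, Tendsto (fun n => stoppedSum T Ξ n t) 𝒰 (𝓝 y) := by
    intro t ht htT
    obtain ⟨N, hN⟩ := (eventually_atTop.mp (herr.eventually (gt_mem_nhds one_pos)))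
    have hz : ∀ n, stoppedSum T Ξ n 0 = 0 := by
      intro n
      refine Finset.sum_eq_zero fun i _ => ?_
      rw [min_eq_right (by positivity), min_eq_right (by positivity), h.diag hθ le_rfl hT]
    have hev : ∀ᶠ n in (𝒰 : Filter ℕ),
        stoppedSum T Ξ n t ∈ Metric.closedBall (Ξ 0 t) (K * (t - 0) ^ θ + 1) := by
      refine h𝒰 ?_
      filter_upwards [eventually_ge_atTop N, eventually_gt_atTop 0] with n hn hn0
      have h3 := h.stoppedSum_sub_le hθ hC le_rfl ht htT hn0
      rw [hz, sub_zero] at h3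
      rw [Metric.mem_closedBall, Real.dist_eq]
      linarith [hN n hn]
    obtain ⟨y, -, hy⟩ := (isCompact_closedBall (Ξ 0 t) (K * (t - 0) ^ θ + 1)).ultrafilter_le_nhds
      (𝒰.map fun n => stoppedSum T Ξ n t) (le_principal_iff.mpr hev)
    exact ⟨y, hy⟩
  choose! F hF using hbdd
  refine ⟨F, K, hK0, fun s t hs hst htT => ?_⟩
  have hl := (((hF t (hs.trans hst) htT).sub (hF s hs (hst.trans htT))).sub_const (Ξ s t)).abs
  have hr : Tendsto (fun n : ℕ => K * (t - s) ^ θ + C * ((T / n) ^ (θ - 1) * T)) 𝒰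
      (𝓝 (K * (t - s) ^ θ)) := by
    simpa using (herr.mono_left h𝒰).const_add (K * (t - s) ^ θ)
  refine le_of_tendsto_of_tendsto hl hr (h𝒰 ?_)
  filter_upwards [eventually_gt_atTop 0] with n hn
  exact h.stoppedSum_sub_le hθ hC hs hst htT hn

end IsAlmostAdditive

namespace IntervalPartition

theorem sum_telescope {a b : ℝ} (π : IntervalPartition a b) (F : ℝ → ℝ) :
    π.sum (fun s u => F u - F s) = F b - F a := by
  have key : ∀ (n : ℕ) (g : Fin (n + 1) → ℝ),
      ∑ i : Fin n, (g i.succ - g i.castSucc) = g (Fin.last n) - g 0 := by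
    intro n
    induction n with
    | zero => intro g; simp
    | succ n ih =>
      intro g
      rw [Fin.sum_univ_castSucc]
      have := ih (fun i => g i.castSucc)
      simp only [Fin.succ_castSucc] at this ⊢
      rw [this]
      simp
  have := key π.n (fun i => F (π.pts i))
  rw [π.first, π.last] at this
  exact this

theorem sub_le_mesh {a b : ℝ} (π : IntervalPartition a b) (i : Fin π.n) :
    π.pts i.succ - π.pts i.castSucc ≤ π.mesh :=
  le_ciSup (f := fun i : Fin π.n => π.pts i.succ - π.pts i.castSucc)
    (Set.finite_range _).bddAbove i

theorem pts_mem {a b : ℝ} (π : IntervalPartition a b) (i : Fin (π.n + 1)) :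
    π.pts i ∈ Icc a b :=
  ⟨π.first.symm.trans_le (π.strictMono_pts.monotone (Fin.zero_le i)),
    (π.strictMono_pts.monotone (Fin.le_last i)).trans_eq π.last⟩

/-- Riemann sums of a germ that agrees with the increments of `F` up to `O(|t - s|^θ)`, `θ > 1`,
converge to the increment of `F`. -/
theorem tendsto_sum_of_sub_le {T K θ : ℝ} {Ξ : ℝ → ℝ → ℝ} {F : ℝ → ℝ} (hθ : 1 < θ)
    (hK : 0 ≤ K)
    (hF : ∀ s t, 0 ≤ s → s ≤ t → t ≤ T → |F t - F s - Ξ s t| ≤ K * (t - s) ^ θ)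
    {t : ℝ} (ht : t ∈ Icc 0 T) :
    Tendsto (fun π : IntervalPartition 0 t => π.sum Ξ) (meshToZero 0 t) (𝓝 (F t - F 0)) := by
  have hb : ∀ π : IntervalPartition 0 t,
      |π.sum Ξ - (F t - F 0)| ≤ K * (π.mesh ^ (θ - 1) * t) := by
    intro π
    rw [← π.sum_telescope F, sum, sum, ← Finset.sum_sub_distrib]
    have hmono : ∀ i : Fin π.n, π.pts i.castSucc ≤ π.pts i.succ :=
      fun i => (π.strictMono_pts i.castSucc_lt_succ).le
    calc _ ≤ ∑ i : Fin π.n, K * (π.pts i.succ - π.pts i.castSucc) ^ θ := by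
          refine (Finset.abs_sum_le_sum_abs _ _).trans (Finset.sum_le_sum fun i _ => ?_)
          rw [abs_sub_comm]
          exact hF _ _ (π.pts_mem _).1 (hmono i) ((π.pts_mem _).2.trans ht.2)
      _ ≤ _ := by
          rw [← Finset.mul_sum]
          refine mul_le_mul_of_nonneg_left ((IsAlmostAdditive.sum_rpow_le _ _
            (fun i _ => sub_nonneg.mpr (hmono i)) hθ (fun i _ => π.sub_le_mesh i)).trans_eq ?_) hK
          have := π.sum_telescope id
          simp only [sum, id, sub_zero] at this
          rw [this]
  have hlim : Tendsto (fun π : IntervalPartition 0 t => K * (π.mesh ^ (θ - 1) * t))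
      (meshToZero 0 t) (𝓝 0) := by
    have h1 : Tendsto (mesh : IntervalPartition 0 t → ℝ) (meshToZero 0 t) (𝓝 0) := tendsto_comap
    have h3 := h1.rpow_const (p := θ - 1) (Or.inr (by linarith))
    rw [Real.zero_rpow (by linarith)] at h3
    simpa using (h3.mul_const t).const_mul K
  rw [tendsto_iff_dist_tendsto_zero]
  exact squeeze_zero (fun _ => dist_nonneg) (fun π => by rw [Real.dist_eq]; exact hb π) hlim

theorem meshToZero_neBot {t : ℝ} (ht : 0 ≤ t) : (meshToZero 0 t).NeBot := by
  rw [meshToZero, comap_neBot_iff]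
  intro S hS
  rcases ht.eq_or_lt with rfl | ht
  · refine ⟨⟨0, fun _ => 0, fun i j hij => absurd hij (by omega), rfl, rfl⟩, ?_⟩
    simpa [mesh] using mem_of_mem_nhds hS
  · have h1 : Tendsto (fun n : ℕ => t / n) atTop (𝓝 0) := tendsto_const_div_atTop_nhds_zero_nat t
    obtain ⟨n, hn, hn0⟩ := ((h1.eventually hS).and (eventually_gt_atTop 0)).exists
    have hn' : (0 : ℝ) < n := Nat.cast_pos.mpr hn0
    have hpos : 0 < t / n := by positivity
    refine ⟨⟨n, fun i => (i : ℕ) * (t / n), fun i j hij => ?_, by simp, ?_⟩, ?_⟩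
    · have : ((i : ℕ) : ℝ) < (j : ℕ) := by exact_mod_cast hij
      exact mul_lt_mul_of_pos_right this hpos
    · simp only [Fin.val_last]; field_simp
    · have : Nonempty (Fin n) := ⟨⟨0, hn0⟩⟩
      have hm : ∀ i : Fin n, (((i.succ : Fin (n + 1)) : ℕ) : ℝ) * (t / n)
          - ((i.castSucc : Fin (n + 1)) : ℕ) * (t / n) = t / n := by
        intro i; simp; ring
      simp only [mesh, hm, ciSup_const]
      exact hn

end IntervalPartition

/-! ### Controlled paths have rough integrals -/

namespace WordSpace

variable {A : Type*}

theorem convolution_word (α β : Module.Dual ℝ (WordSpace A)) (w : List A) :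
    convolution α β (word w) =
      ∑ i ∈ Finset.range (w.length + 1), α (word (w.take i)) * β (word (w.drop i)) := by
  simp [convolution, deconcatenation, word, Finsupp.linearCombination_single]

theorem dual_apply_eq_sum (α : Module.Dual ℝ (WordSpace A)) (y : WordSpace A)
    (S : Finset (List A)) (hS : ∀ w, w ∉ S → y w = 0) : α y = ∑ w ∈ S, y w * α (word w) := by
  have hsub : y.support ⊆ S := fun w hw => by
    by_contra h
    exact Finsupp.mem_support_iff.mp hw (hS w h)
  conv_lhs => rw [← Finsupp.sum_single y]
  rw [Finsupp.sum_of_support_subset y hsub _ (by simp), map_sum]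
  refine Finset.sum_congr rfl fun w _ => ?_
  rw [word, ← smul_eq_mul, ← map_smul, Finsupp.smul_single, smul_eq_mul, mul_one]

theorem dualWord_apply (u : List A) (y : WordSpace A) : dualWord u y = y u := rfl

end WordSpace

namespace GradedBracket

open WordSpace

variable {A : Type*} (B : GradedBracket A)

theorem weight_nil : B.weight [] = 0 := rfl

theorem weight_append (u v : List A) : B.weight (u ++ v) = B.weight u + B.weight v := by
  simp [weight]

theorem weight_singleton (a : A) : B.weight [a] = B.letterWeight a := by simp [weight]

theorem length_le_weight (w : List A) : w.length ≤ B.weight w := by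
  induction w with
  | nil => simp
  | cons a w ih =>
    have := B.letterWeight_pos a
    simp only [weight, List.map_cons, List.sum_cons, List.length_cons] at *
    omega

theorem word_mem_truncated {n : ℕ} {w : List A} (h : B.weight w ≤ n) :
    word w ∈ B.truncated n := Finsupp.single_mem_supported ℝ 1 h

theorem IsQuasiGeometricRoughPath.chen_word {B : GradedBracket A} {γ T : ℝ}
    {X : ℝ → ℝ → Module.Dual ℝ (WordSpace A)}
    (hX : B.IsQuasiGeometricRoughPath γ T X) {s u t : ℝ} (hs : s ∈ Icc 0 T) (hu : u ∈ Icc 0 T)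
    (ht : t ∈ Icc 0 T) {w : List A} (hw : B.weight w ≤ roughLevel γ) :
    X s t (word w) =
      ∑ i ∈ Finset.range (w.length + 1), X s u (word (w.take i)) * X u t (word (w.drop i)) := by
  rw [← convolution_word, hX.chen s hs u hu t ht _ (B.word_mem_truncated hw)]

/-- On the diagonal a rough path is the counit: Chen's relation makes `X s s` idempotent for the
convolution. -/
theorem IsQuasiGeometricRoughPath.diag {B : GradedBracket A} {γ T : ℝ}
    {X : ℝ → ℝ → Module.Dual ℝ (WordSpace A)}
    (hX : B.IsQuasiGeometricRoughPath γ T X) {s : ℝ} (hs : s ∈ Icc 0 T) (w : List A)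
    (hw : B.weight w ≤ roughLevel γ) (hne : w ≠ []) : X s s (word w) = 0 := by
  induction hk : w.length using Nat.strong_induction_on generalizing w with
  | _ k ih =>
    obtain ⟨m, hm⟩ : ∃ m, w.length = m + 1 :=
      ⟨w.length - 1, (Nat.sub_add_cancel (List.length_pos_iff.mpr hne)).symm⟩
    have h := hX.chen_word hs hs hs hw
    rw [hm, Finset.sum_range_succ, Finset.sum_range_succ', ← hm, List.take_length,
      List.drop_length, List.take_zero, List.drop_zero, hX.unit s hs s hs,
      Finset.sum_eq_zero] at h
    · linarith
    · intro i hi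
      rw [Finset.mem_range] at hi
      have hsplit := B.weight_append (w.take (i + 1)) (w.drop (i + 1))
      rw [List.take_append_drop] at hsplit
      rw [ih (w.drop (i + 1)).length (by rw [List.length_drop]; omega) _ (by omega) ?_ rfl,
        mul_zero]
      intro h0
      have := congrArg List.length h0
      rw [List.length_drop, List.length_nil] at this
      omega

/-- The Hölder bound of a rough path, extended to `s = t`, where it holds because `X s s` is the
counit. -/
theorem IsQuasiGeometricRoughPath.exists_bound {B : GradedBracket A} {γ T : ℝ}
    {X : ℝ → ℝ → Module.Dual ℝ (WordSpace A)}
    (hX : B.IsQuasiGeometricRoughPath γ T X) (w : List A) :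
    ∃ C : ℝ, 0 ≤ C ∧ (B.weight w ≤ roughLevel γ → ∀ s ∈ Icc 0 T, ∀ t ∈ Icc 0 T,
      |X s t (word w)| ≤ C * |t - s| ^ (γ * (B.weight w : ℝ))) := by
  by_cases hw : B.weight w ≤ roughLevel γ
  · obtain ⟨C, hC⟩ := hX.bound w hw
    refine ⟨max C 1, by positivity, fun _ s hs t ht => ?_⟩
    have hpow : 0 ≤ |t - s| ^ (γ * (B.weight w : ℝ)) := Real.rpow_nonneg (abs_nonneg _) _
    rcases eq_or_ne s t with rfl | hst
    · by_cases hne : w = []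
      · subst hne
        simp [hX.unit s hs s hs, weight_nil]
      · rw [hX.diag hs w hw hne, abs_zero]
        positivity
    · exact (hC s hs t ht hst).trans (mul_le_mul_of_nonneg_right (le_max_left _ _) hpow)
  · exact ⟨0, le_rfl, fun h => absurd h hw⟩

theorem finite_weight_le [Finite A] (n : ℕ) : {w : List A | B.weight w ≤ n}.Finite :=
  (List.finite_length_le A n).subset fun w hw => (B.length_le_weight w).trans hw

/-- The finite set of the words of weight at most `n` over a finite alphabet. -/
noncomputable def words [Finite A] (n : ℕ) : Finset (List A) := (B.finite_weight_le n).toFinset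

variable [Finite A]

theorem mem_words {n : ℕ} {w : List A} : w ∈ B.words n ↔ B.weight w ≤ n := by simp [words]

/-- Summing over the words and their deconcatenations is summing over pairs of words. -/
theorem sum_words_take_drop (n : ℕ) (f : List A → List A → ℝ) :
    ∑ w ∈ B.words n, ∑ i ∈ Finset.range (w.length + 1), f (w.take i) (w.drop i) =
      ∑ u ∈ B.words n, ∑ v ∈ B.words (n - B.weight u), f v u := by
  rw [Finset.sum_sigma', Finset.sum_sigma']
  refine Finset.sum_bij' (fun p _ => ⟨p.1.drop p.2, p.1.take p.2⟩)
    (fun q _ => ⟨q.2 ++ q.1, q.2.length⟩) ?_ ?_ ?_ ?_ ?_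
  · rintro ⟨w, i⟩ h
    simp only [Finset.mem_sigma, mem_words, Finset.mem_range] at h ⊢
    have := B.weight_append (w.take i) (w.drop i)
    rw [List.take_append_drop] at this
    omega
  · rintro ⟨u, v⟩ h
    simp only [Finset.mem_sigma, mem_words, Finset.mem_range, weight_append,
      List.length_append] at h ⊢
    omega
  · rintro ⟨w, i⟩ h
    simp only [Finset.mem_sigma, mem_words, Finset.mem_range] at h
    simp only [List.take_append_drop, List.length_take]
    rw [min_eq_left (by omega)]
  · rintro ⟨u, v⟩ h
    simp
  · rintro ⟨w, i⟩ h
    rfl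

theorem convolution_dualWord (α : Module.Dual ℝ (WordSpace A)) (y : WordSpace A) {n : ℕ}
    (hy : ∀ w, n < B.weight w → y w = 0) {u : List A} (hu : B.weight u ≤ n) :
    convolution α (dualWord u) y =
      ∑ v ∈ B.words (n - B.weight u), y (v ++ u) * α (word v) := by
  classical
  rw [dual_apply_eq_sum _ y (B.words n) fun w hw => hy w (by rwa [mem_words, not_le] at hw)]
  have h := B.sum_words_take_drop n
    fun v u' => y (v ++ u') * (α (word v) * dualWord u (word u'))
  simp only [List.take_append_drop] at h
  simp only [convolution_word, Finset.mul_sum]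
  rw [h, Finset.sum_eq_single u]
  · simp [dualWord, word]
  · intro b _ hb
    refine Finset.sum_eq_zero fun v _ => ?_
    simp [dualWord, word, hb]
  · intro h
    exact absurd (B.mem_words.mpr hu) h

variable {B} {γ T : ℝ} {X : ℝ → ℝ → Module.Dual ℝ (WordSpace A)} {Y : ℝ → WordSpace A}

/-- The remainder estimate of a controlled path with the convolution written out on words, extended
to `s = t`. -/
theorem IsControlled.exists_remainder {n : ℕ} (hY : B.IsControlled γ T X (n + 1) Y)
    (hX : B.IsQuasiGeometricRoughPath γ T X) (hn : n ≤ roughLevel γ) (u : List A) :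
    ∃ C : ℝ, 0 ≤ C ∧ (B.weight u ≤ n → ∀ s ∈ Icc 0 T, ∀ t ∈ Icc 0 T,
      |Y t u - ∑ v ∈ B.words (n - B.weight u), Y s (v ++ u) * X s t (word v)|
        ≤ C * |t - s| ^ (((n + 1 : ℕ) - (B.weight u : ℝ)) * γ)) := by
  by_cases hu : B.weight u ≤ n
  · obtain ⟨C, hC⟩ := hY.remainder u (by omega)
    refine ⟨max C 0, le_max_right _ _, fun _ s hs t ht => ?_⟩
    have hpow : 0 ≤ |t - s| ^ (((n + 1 : ℕ) - (B.weight u : ℝ)) * γ) :=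
      Real.rpow_nonneg (abs_nonneg _) _
    rcases eq_or_ne s t with rfl | hst
    · rw [Finset.sum_eq_single []]
      · rw [List.nil_append, hX.unit s hs s hs, mul_one, sub_self, abs_zero]
        positivity
      · intro v hv hne
        rw [hX.diag hs v ((B.mem_words.mp hv).trans (by omega)) hne, mul_zero]
      · intro h
        exact absurd (B.mem_words.mpr (Nat.zero_le _)) h
    · refine le_trans ?_ ((hC s hs t ht hst).trans
        (mul_le_mul_of_nonneg_right (le_max_left _ _) hpow))
      rw [B.convolution_dualWord (n := n) _ _ (fun w hw => hY.mem s hs w hw) hu, dualWord_apply]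
  · exact ⟨0, le_rfl, fun h => absurd h hu⟩

theorem integralGerm_eq_sum {a : A} {n : ℕ} (hn : n + B.letterWeight a = roughLevel γ) {s : ℝ}
    (hy : ∀ w, n < B.weight w → Y s w = 0) (u : ℝ) :
    B.integralGerm γ X Y a s u = ∑ v ∈ B.words n, Y s v * X s u (word (v ++ [a])) := by
  classical
  have hf : (Y s).filter (fun v => B.weight v + B.letterWeight a ≤ roughLevel γ) = Y s := by
    refine Finsupp.filter_eq_self_iff _ _ |>.mpr fun w hw => ?_
    by_contra hcon
    exact hw (hy w (by omega))
  rw [integralGerm, hf]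
  refine Finsupp.sum_of_support_subset _ (fun w hw => ?_) _ (by simp)
  rw [mem_words]
  by_contra hcon
  exact Finsupp.mem_support_iff.mp hw (hy w (by omega))

/-- By Chen's relation the defect of additivity of the germ is the sum of the products of the
remainders of `Y` with the increments `X u t (v a)`. -/
theorem integralGerm_sub_sub (hX : B.IsQuasiGeometricRoughPath γ T X) {a : A} {n : ℕ}
    (hn : n + B.letterWeight a = roughLevel γ)
    (hy : ∀ t ∈ Icc 0 T, ∀ w, n < B.weight w → Y t w = 0) {s u t : ℝ} (hs : s ∈ Icc 0 T)
    (hu : u ∈ Icc 0 T) (ht : t ∈ Icc 0 T) :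
    B.integralGerm γ X Y a s t - B.integralGerm γ X Y a s u - B.integralGerm γ X Y a u t =
      ∑ w ∈ B.words n, -((Y u w - ∑ v ∈ B.words (n - B.weight w), Y s (v ++ w) * X s u (word v))
        * X u t (word (w ++ [a]))) := by
  rw [integralGerm_eq_sum hn (hy s hs), integralGerm_eq_sum hn (hy s hs),
    integralGerm_eq_sum hn (hy u hu)]
  have hsplit : ∀ v ∈ B.words n, Y s v * X s t (word (v ++ [a])) =
      Y s v * X s u (word (v ++ [a])) + ∑ i ∈ Finset.range (v.length + 1),
        Y s (v.take i ++ v.drop i) * X s u (word (v.take i))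
          * X u t (word (v.drop i ++ [a])) := by
    intro v hv
    rw [mem_words] at hv
    rw [hX.chen_word hs hu ht (by rw [weight_append, weight_singleton]; omega),
      List.length_append, List.length_singleton, Finset.sum_range_succ, mul_add, add_comm]
    congr 1
    · rw [List.take_of_length_le (by simp), List.drop_of_length_le (by simp),
        hX.unit u hu t ht, mul_one]
    · rw [Finset.mul_sum]
      refine Finset.sum_congr rfl fun i hi => ?_
      rw [Finset.mem_range] at hi
      rw [List.take_append_drop, List.take_append_of_le_length (by omega),
        List.drop_append_of_le_length (by omega), mul_assoc]
  rw [Finset.sum_congr rfl hsplit, Finset.sum_add_distrib,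
    B.sum_words_take_drop n fun v w =>
      Y s (v ++ w) * X s u (word v) * X u t (word (w ++ [a]))]
  rw [add_sub_cancel_left, ← Finset.sum_sub_distrib]
  refine Finset.sum_congr rfl fun w _ => ?_
  rw [← Finset.sum_mul]
  ring

/-- The germ of the integral of a controlled path is almost additive with exponent
`(N + 1) γ`. -/
theorem IsControlled.exists_isAlmostAdditive (hγ : 0 < γ) {a : A} {n : ℕ}
    (hY : B.IsControlled γ T X (n + 1) Y) (hX : B.IsQuasiGeometricRoughPath γ T X)
    (hn : n + B.letterWeight a = roughLevel γ) :
    ∃ C : ℝ, 0 ≤ C ∧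
      IsAlmostAdditive T C ((roughLevel γ + 1 : ℕ) * γ) (B.integralGerm γ X Y a) := by
  choose C₁ hC₁ hR using hY.exists_remainder hX (by omega)
  choose C₂ hC₂ hb using hX.exists_bound
  refine ⟨∑ w ∈ B.words n, C₁ w * C₂ (w ++ [a]),
    Finset.sum_nonneg fun w _ => mul_nonneg (hC₁ w) (hC₂ _), fun s u t h0 hsu hut hT => ?_⟩
  have hs : s ∈ Icc 0 T := ⟨h0, hsu.trans (hut.trans hT)⟩
  have hu : u ∈ Icc 0 T := ⟨h0.trans hsu, hut.trans hT⟩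
  have ht : t ∈ Icc 0 T := ⟨hu.1.trans hut, hT⟩
  rw [integralGerm_sub_sub hX hn (fun t ht w hw => hY.mem t ht w hw) hs hu ht, Finset.sum_mul]
  refine (Finset.abs_sum_le_sum_abs _ _).trans (Finset.sum_le_sum fun w hw => ?_)
  rw [mem_words] at hw
  have hwt : B.weight (w ++ [a]) = B.weight w + B.letterWeight a := by
    rw [weight_append, weight_singleton]
  have h1 := hR w hw s hs u hu
  have h2 := hb (w ++ [a]) (by omega) u hu t ht
  have hexp : 0 ≤ ((n + 1 : ℕ) - (B.weight w : ℝ)) * γ := by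
    refine mul_nonneg (sub_nonneg.mpr ?_) hγ.le
    exact_mod_cast hw.trans n.le_succ
  have hle1 : |u - s| ≤ t - s := by rw [abs_of_nonneg (by linarith)]; linarith
  have hle2 : |t - u| ≤ t - s := by rw [abs_of_nonneg (by linarith)]; linarith
  rw [abs_neg, abs_mul]
  calc _ ≤ (C₁ w * |u - s| ^ (((n + 1 : ℕ) - (B.weight w : ℝ)) * γ))
        * (C₂ (w ++ [a]) * |t - u| ^ (γ * (B.weight (w ++ [a]) : ℝ))) :=
        mul_le_mul h1 h2 (abs_nonneg _) (mul_nonneg (hC₁ w) (Real.rpow_nonneg (abs_nonneg _) _))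
    _ ≤ (C₁ w * (t - s) ^ (((n + 1 : ℕ) - (B.weight w : ℝ)) * γ))
        * (C₂ (w ++ [a]) * (t - s) ^ (γ * (B.weight (w ++ [a]) : ℝ))) := by
        have := hC₁ w
        have := hC₂ (w ++ [a])
        have h3 : 0 ≤ t - s := by linarith
        gcongr
    _ = _ := by
        have h3 : 0 ≤ t - s := by linarith
        have h4 : (((roughLevel γ + 1 : ℕ) : ℝ) * γ) = ((n + 1 : ℕ) - (B.weight w : ℝ)) * γ +
            γ * (B.weight (w ++ [a]) : ℝ) := by
          rw [hwt, ← hn]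
          push_cast
          ring
        rw [h4, Real.rpow_add_of_nonneg h3 hexp (by positivity)]
        ring

end GradedBracket

theorem one_lt_roughLevel_add_one_mul {γ : ℝ} (hγ : 0 < γ) :
    1 < ((roughLevel γ + 1 : ℕ) : ℝ) * γ := by
  have h := mul_lt_mul_of_pos_right (Nat.lt_floor_add_one γ⁻¹) hγ
  rw [inv_mul_cancel₀ hγ.ne'] at h
  exact_mod_cast h

/-- A controlled path of order `N + 1 - ω(a)` has a geometric rough integral against the
letter `a`. -/
theorem GradedBracket.IsControlled.exists_hasGeomRoughIntegral {A : Type*} [Finite A]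
    {B : GradedBracket A} {γ T : ℝ} {X : ℝ → ℝ → Module.Dual ℝ (WordSpace A)}
    {Y : ℝ → WordSpace A} (hγ : 0 < γ) (hT : 0 ≤ T) {a : A} {n : ℕ}
    (hY : B.IsControlled γ T X (n + 1) Y) (hX : B.IsQuasiGeometricRoughPath γ T X)
    (hn : n + B.letterWeight a = roughLevel γ) :
    ∃ I : ℝ → ℝ, ∀ t ∈ Icc 0 T, B.HasGeomRoughIntegral γ X Y a t (I t) := by
  obtain ⟨C, hC, h⟩ := hY.exists_isAlmostAdditive hγ hX hn
  have hθ := one_lt_roughLevel_add_one_mul hγ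
  obtain ⟨F, K, hK, hF⟩ := h.exists_sewing hθ hC hT
  exact ⟨fun t => F t - F 0, fun t ht => IntervalPartition.tendsto_sum_of_sub_le hθ hK hF ht⟩

/-! ### Iterated partial derivatives and Taylor's formula -/

section Derivatives

variable {d : ℕ}

/-- The list of the indices `0, …, d - 1` in which `i` is repeated `k i` times. -/
def indexList (k : Fin d → ℕ) : List (Fin d) :=
  (List.finRange d).flatMap fun i => List.replicate (k i) i

theorem count_indexList (k : Fin d → ℕ) (i : Fin d) : (indexList k).count i = k i := by
  rw [indexList, List.count_flatMap]
  have h : (List.count i ∘ fun j => List.replicate (k j) j) = fun j => if j = i then k i else 0 := by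
    funext j
    by_cases hj : j = i
    · subst hj; simp
    · simp [List.count_replicate, hj]
  rw [h, ← List.ofFn_eq_map, List.sum_ofFn]
  simp

theorem length_indexList (k : Fin d → ℕ) : (indexList k).length = ∑ i, k i := by
  rw [indexList, List.length_flatMap]
  simp only [List.length_replicate]
  rw [← List.ofFn_eq_map, List.sum_ofFn]

theorem indexList_add_perm (k l : Fin d → ℕ) :
    (indexList (k + l)).Perm (indexList k ++ indexList l) := by
  rw [List.perm_iff_count]
  intro i
  simp [List.count_append, count_indexList]

theorem multiDeriv_eq_foldr (k : Fin d → ℕ) (f : EuclideanSpace ℝ (Fin d) → ℝ) :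
    multiDeriv k f = (indexList k).foldr partialDeriv f := by
  have hrep : ∀ (n : ℕ) (i : Fin d) (g : EuclideanSpace ℝ (Fin d) → ℝ),
      (List.replicate n i).foldr partialDeriv g = (partialDeriv i)^[n] g := by
    intro n i g
    induction n with
    | zero => rfl
    | succ n ih => rw [List.replicate_succ, List.foldr_cons, ih, Function.iterate_succ_apply']
  rw [multiDeriv, indexList]
  induction List.finRange d with
  | nil => rfl
  | cons i L ih => rw [List.foldr_cons, List.flatMap_cons, List.foldr_append, ← ih, hrep]

theorem multiDeriv_zero (f : EuclideanSpace ℝ (Fin d) → ℝ) : multiDeriv 0 f = f := by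
  simp only [multiDeriv, Pi.zero_apply, Function.iterate_zero, id]
  exact List.foldr_fixed _

theorem partialDeriv_eq_fderiv {f : EuclideanSpace ℝ (Fin d) → ℝ} (hf : Differentiable ℝ f)
    (i : Fin d) : partialDeriv i f = fun y => fderiv ℝ f y (EuclideanSpace.single i 1) :=
  funext fun y => (hf y).lineDeriv_eq_fderiv

theorem contDiff_partialDeriv {n : ℕ} {f : EuclideanSpace ℝ (Fin d) → ℝ}
    (hf : ContDiff ℝ (n + 1 : ℕ) f) (i : Fin d) : ContDiff ℝ n (partialDeriv i f) := by
  rw [partialDeriv_eq_fderiv (hf.differentiable (by simp))]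
  exact (hf.fderiv_right (m := n) (by norm_cast)).clm_apply contDiff_const

theorem partialDeriv_comm {f : EuclideanSpace ℝ (Fin d) → ℝ} (hf : ContDiff ℝ (2 : ℕ) f)
    (i j : Fin d) : partialDeriv i (partialDeriv j f) = partialDeriv j (partialDeriv i f) := by
  have hd : Differentiable ℝ f := hf.differentiable (by simp)
  have hd' : Differentiable ℝ (fderiv ℝ f) :=
    (hf.fderiv_right (m := (1 : ℕ)) (by norm_cast)).differentiable (by simp)
  have key : ∀ i j : Fin d, partialDeriv i (partialDeriv j f) = fun y =>
      fderiv ℝ (fderiv ℝ f) y (EuclideanSpace.single i 1) (EuclideanSpace.single j 1) := by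
    intro i j
    rw [partialDeriv_eq_fderiv ((contDiff_partialDeriv (n := 1) hf j).differentiable (by simp)),
      partialDeriv_eq_fderiv hd]
    funext y
    rw [fderiv_clm_apply (hd' y) (differentiableAt_const _)]
    simp
  rw [key i j, key j i]
  funext y
  have hs : IsSymmSndFDerivAt ℝ f y := hf.contDiffAt.isSymmSndFDerivAt (by simp)
  exact hs _ _

theorem contDiff_foldr_partialDeriv (L : List (Fin d)) {n : ℕ}
    {f : EuclideanSpace ℝ (Fin d) → ℝ} (hf : ContDiff ℝ (n + L.length : ℕ) f) :
    ContDiff ℝ n (L.foldr partialDeriv f) := by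
  induction L generalizing n with
  | nil => exact hf
  | cons i L ih =>
    refine contDiff_partialDeriv (ih ?_) i
    rwa [List.length_cons, add_comm L.length, ← add_assoc] at hf

/-- Iterated partial derivatives do not depend on the order of differentiation. -/
theorem foldr_partialDeriv_perm {L L' : List (Fin d)} (h : L.Perm L')
    {f : EuclideanSpace ℝ (Fin d) → ℝ} (hf : ContDiff ℝ (L.length : ℕ) f) :
    L.foldr partialDeriv f = L'.foldr partialDeriv f := by
  induction h with
  | nil => rfl
  | cons i _ ih =>
    rw [List.foldr_cons, List.foldr_cons, ih (hf.of_le (by simp))]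
  | swap i j L =>
    simp only [List.foldr_cons]
    refine partialDeriv_comm (contDiff_foldr_partialDeriv L (hf.of_le ?_)) _ _
    simp only [List.length_cons]
    exact_mod_cast (by omega)
  | trans h1 _ ih1 ih2 => rw [ih1 hf, ih2 (by rwa [← h1.length_eq])]

theorem multiDeriv_multiDeriv (k l : Fin d → ℕ) {f : EuclideanSpace ℝ (Fin d) → ℝ}
    (hf : ContDiff ℝ (∑ i, (k + l) i : ℕ) f) :
    multiDeriv l (multiDeriv k f) = multiDeriv (k + l) f := by
  simp only [multiDeriv_eq_foldr]
  rw [← List.foldr_append, add_comm k l]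
  refine (foldr_partialDeriv_perm (indexList_add_perm l k) ?_).symm
  rwa [length_indexList, add_comm l k]

theorem contDiff_multiDeriv (k : Fin d → ℕ) {n : ℕ} {f : EuclideanSpace ℝ (Fin d) → ℝ}
    (hf : ContDiff ℝ (n + ∑ i, k i : ℕ) f) : ContDiff ℝ n (multiDeriv k f) := by
  rw [multiDeriv_eq_foldr]
  exact contDiff_foldr_partialDeriv _ (by rwa [length_indexList])

theorem partialDeriv_multiDeriv (k : Fin d → ℕ) (i : Fin d) {f : EuclideanSpace ℝ (Fin d) → ℝ}
    (hf : ContDiff ℝ (∑ j, k j + 1 : ℕ) f) :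
    partialDeriv i (multiDeriv k f) = multiDeriv (k + Pi.single i 1) f := by
  simp only [multiDeriv_eq_foldr]
  have hp : (i :: indexList k).Perm (indexList (k + Pi.single i 1)) := by
    rw [List.perm_iff_count]
    intro j
    by_cases hj : j = i
    · subst hj; simp [count_indexList]
    · simp [count_indexList, hj, Ne.symm hj]
  exact foldr_partialDeriv_perm hp (by rwa [List.length_cons, length_indexList])

end Derivatives

section Taylor

variable {d : ℕ}

theorem multiFactorial_add_single (l : Fin d → ℕ) (i : Fin d) :
    multiFactorial (l + Pi.single i 1) = (l i + 1) * multiFactorial l := by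
  rw [multiFactorial, multiFactorial, ← Finset.mul_prod_erase _ _ (Finset.mem_univ i),
    ← Finset.mul_prod_erase (a := i) _ (fun j => (l j).factorial) (Finset.mem_univ i), ← mul_assoc]
  congr 1
  · simp [Nat.factorial_succ]
  · refine Finset.prod_congr rfl fun j hj => ?_
    simp [(Finset.mem_erase.mp hj).1]

theorem multiFactorial_ne_zero (l : Fin d → ℕ) : (multiFactorial l : ℝ) ≠ 0 :=
  Nat.cast_ne_zero.mpr (Finset.prod_ne_zero_iff.mpr fun _ _ => Nat.factorial_ne_zero _)

/-- The homogeneous part of order `j` of the multinomial expansion,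
`∑_{|l| = j} h^l / l! · F l`. -/
noncomputable def multinomialSum (h : Fin d → ℝ) (j : ℕ) (F : (Fin d → ℕ) → ℝ) : ℝ :=
  ∑ l ∈ Finset.piAntidiag (Finset.univ : Finset (Fin d)) j,
    (∏ i, h i ^ l i) / (multiFactorial l : ℝ) * F l

theorem mem_piAntidiag_univ {j : ℕ} {l : Fin d → ℕ} :
    l ∈ Finset.piAntidiag (Finset.univ : Finset (Fin d)) j ↔ ∑ i, l i = j := by
  simp [Finset.mem_piAntidiag]

theorem sum_add_single (l : Fin d → ℕ) (i : Fin d) :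
    ∑ j, (l + Pi.single i 1 : Fin d → ℕ) j = ∑ j, l j + 1 := by
  simp [Finset.sum_add_distrib]

/-- The multinomial recursion, `(h · ∂)(h · ∂)^j = (h · ∂)^{j + 1}` in terms of symbols. -/
theorem sum_mul_multinomialSum (h : Fin d → ℝ) (j : ℕ) (F : (Fin d → ℕ) → ℝ) :
    ∑ i, h i * multinomialSum h j (fun l => F (l + Pi.single i 1)) =
      (j + 1) * multinomialSum h (j + 1) F := by
  have key : ∀ i, h i * multinomialSum h j (fun l => F (l + Pi.single i 1)) =
      ∑ m ∈ Finset.piAntidiag (Finset.univ : Finset (Fin d)) (j + 1),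
        (m i : ℝ) * ((∏ i, h i ^ m i) / (multiFactorial m : ℝ) * F m) := by
    intro i
    rw [multinomialSum, Finset.mul_sum]
    refine Finset.sum_of_injOn (fun l => l + Pi.single i 1) (fun a _ b _ hab => add_right_cancel hab)
      (fun l hl => ?_) (fun m hm hm' => ?_) (fun l hl => ?_)
    · rw [Finset.mem_coe, mem_piAntidiag_univ] at hl ⊢
      rw [sum_add_single, hl]
    · rcases Nat.eq_zero_or_pos (m i) with h0 | h0
      · simp [h0]
      · exfalso
        have hmi : m - Pi.single i 1 + Pi.single i 1 = m := by
          funext k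
          by_cases hk : k = i
          · subst hk; simp; omega
          · simp [hk]
        refine hm' ⟨m - Pi.single i 1, ?_, hmi⟩
        rw [Finset.mem_coe, mem_piAntidiag_univ]
        rw [mem_piAntidiag_univ, ← hmi, sum_add_single] at hm
        omega
    · have hprod : ∏ k, h k ^ (l + Pi.single i 1 : Fin d → ℕ) k = h i * ∏ k, h k ^ l k := by
        simp only [Pi.add_apply, pow_add, Finset.prod_mul_distrib]
        rw [mul_comm]
        congr 1
        rw [Finset.prod_eq_single i] <;> simp +contextual
      rw [hprod, multiFactorial_add_single]
      have := multiFactorial_ne_zero l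
      simp only [Pi.add_apply, Pi.single_eq_same]
      push_cast
      field_simp
  rw [Finset.sum_congr rfl fun i _ => key i, Finset.sum_comm, multinomialSum, Finset.mul_sum]
  refine Finset.sum_congr rfl fun m hm => ?_
  rw [← Finset.sum_mul]
  rw [mem_piAntidiag_univ] at hm
  congr 1
  exact_mod_cast hm

/-- Taylor's formula for a chain `G 0, …, G m` of successive derivatives. -/
theorem taylor_chain (m : ℕ) {G : ℕ → ℝ → ℝ} {C : ℝ}
    (hG : ∀ j < m, ∀ t, HasDerivAt (G j) (G (j + 1) t) t) (hC : ∀ t ∈ Icc (0 : ℝ) 1, |G m t| ≤ C)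
    {t : ℝ} (ht : t ∈ Icc (0 : ℝ) 1) :
    |G 0 t - ∑ j ∈ Finset.range m, G j 0 * t ^ j / (j.factorial : ℝ)| ≤ C := by
  induction m generalizing G t with
  | zero => simpa using hC t ht
  | succ m ih =>
    have ih' : ∀ t ∈ Icc (0 : ℝ) 1,
        |G 1 t - ∑ j ∈ Finset.range m, G (j + 1) 0 * t ^ j / (j.factorial : ℝ)| ≤ C :=
      fun t ht => ih (G := fun j => G (j + 1)) (fun j hj t => hG (j + 1) (by omega) t) hC ht
    set f : ℝ → ℝ := fun t =>
      G 0 t - ∑ j ∈ Finset.range (m + 1), G j 0 * t ^ j / (j.factorial : ℝ) with hf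
    have hder : ∀ t, HasDerivAt f
        (G 1 t - ∑ j ∈ Finset.range m, G (j + 1) 0 * t ^ j / (j.factorial : ℝ)) t := by
      intro t
      refine (hG 0 (by omega) t).sub ?_
      have h1 : ∀ j ∈ Finset.range (m + 1), HasDerivAt
          (fun t : ℝ => G j 0 * t ^ j / (j.factorial : ℝ))
          (G j 0 * (j * t ^ (j - 1)) / (j.factorial : ℝ)) t := fun j _ =>
        ((hasDerivAt_pow j t).const_mul _).div_const _
      refine (HasDerivAt.fun_sum h1).congr_deriv ?_
      rw [Finset.sum_range_succ']
      simp only [Nat.cast_zero, zero_mul, mul_zero, zero_div, add_zero, Nat.add_sub_cancel]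
      refine Finset.sum_congr rfl fun j _ => ?_
      have := Nat.cast_ne_zero (R := ℝ).mpr j.factorial_ne_zero
      rw [Nat.factorial_succ]
      push_cast
      field_simp
    have hf0 : f 0 = 0 := by
      simp [hf, Finset.sum_range_succ']
    have hC0 : 0 ≤ C := (abs_nonneg _).trans (hC 0 (by simp))
    have hmv := (convex_Icc (0 : ℝ) 1).norm_image_sub_le_of_norm_hasDerivWithin_le
      (fun t _ => (hder t).hasDerivWithinAt) (fun t ht => (ih' t ht : ‖_‖ ≤ C))
      (left_mem_Icc.mpr zero_le_one) ht
    rw [hf0, sub_zero, sub_zero, Real.norm_eq_abs, Real.norm_eq_abs, abs_of_nonneg ht.1] at hmv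
    exact hmv.trans (mul_le_of_le_one_right hC0 ht.2)

theorem hasDerivAt_comp_line {f : EuclideanSpace ℝ (Fin d) → ℝ} (hf : Differentiable ℝ f)
    (y h : EuclideanSpace ℝ (Fin d)) (t : ℝ) :
    HasDerivAt (fun t : ℝ => f (y + t • h)) (∑ i, h i * partialDeriv i f (y + t • h)) t := by
  have h1 : HasDerivAt (fun t : ℝ => y + t • h) h t := by
    simpa using ((hasDerivAt_id t).smul_const h).const_add y
  have h2 := (hf (y + t • h)).hasFDerivAt.comp_hasDerivAt t h1
  refine h2.congr_deriv ?_
  have h3 : h = ∑ i, h i • EuclideanSpace.single i (1 : ℝ) := by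
    ext j
    simp [Pi.single_apply]
  conv_lhs => rw [h3]
  rw [map_sum]
  refine Finset.sum_congr rfl fun i _ => ?_
  rw [map_smul, smul_eq_mul, partialDeriv_eq_fderiv hf, ← h3]

theorem abs_prod_pow_le (h : EuclideanSpace ℝ (Fin d)) (l : Fin d → ℕ) :
    |∏ i, h i ^ l i| ≤ ‖h‖ ^ ∑ i, l i := by
  rw [Finset.abs_prod, ← Finset.prod_pow_eq_pow_sum]
  refine Finset.prod_le_prod (fun i _ => abs_nonneg _) fun i _ => ?_
  rw [abs_pow]
  exact pow_le_pow_left₀ (abs_nonneg _) (PiLp.norm_apply_le h i) _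

/-- Taylor's formula in several variables, in terms of iterated partial derivatives. -/
theorem exists_taylor_bound {m : ℕ} {f : EuclideanSpace ℝ (Fin d) → ℝ} (hf : ContDiff ℝ m f)
    (hb : ∀ l : Fin d → ℕ, ∑ i, l i = m → ∃ C : ℝ, ∀ y, |multiDeriv l f y| ≤ C) :
    ∃ C : ℝ, 0 ≤ C ∧ ∀ y h : EuclideanSpace ℝ (Fin d),
      |f (y + h) - ∑ j ∈ Finset.range m, multinomialSum h j (fun l => multiDeriv l f y)|
        ≤ C * ‖h‖ ^ m := by
  choose! b hb using hb
  refine ⟨m.factorial * ∑ l ∈ Finset.piAntidiag (Finset.univ : Finset (Fin d)) m, |b l|,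
    by positivity, fun y h => ?_⟩
  let G : ℕ → ℝ → ℝ := fun j t =>
    j.factorial * multinomialSum h j (fun l => multiDeriv l f (y + t • h))
  have hG : ∀ j < m, ∀ t, HasDerivAt (G j) (G (j + 1) t) t := by
    intro j hj t
    have h1 : ∀ l ∈ Finset.piAntidiag (Finset.univ : Finset (Fin d)) j,
        HasDerivAt (fun t : ℝ => (∏ i, h i ^ l i) / (multiFactorial l : ℝ)
            * multiDeriv l f (y + t • h))
          ((∏ i, h i ^ l i) / (multiFactorial l : ℝ)
            * ∑ i, h i * multiDeriv (l + Pi.single i 1) f (y + t • h)) t := by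
      intro l hl
      rw [mem_piAntidiag_univ] at hl
      have hd : Differentiable ℝ (multiDeriv l f) :=
        (contDiff_multiDeriv l (n := 1) (hf.of_le (by rw [hl]; exact_mod_cast (by omega)))
          ).differentiable (by simp)
      have h2 := hasDerivAt_comp_line hd y h t
      simp only [partialDeriv_multiDeriv l _
        (hf.of_le (by rw [hl]; exact_mod_cast (by omega)))] at h2
      exact h2.const_mul _
    refine ((HasDerivAt.fun_sum h1).const_mul (j.factorial : ℝ)).congr_deriv ?_
    have h3 := sum_mul_multinomialSum h j (fun l => multiDeriv l f (y + t • h))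
    simp only [G, Nat.factorial_succ]
    push_cast
    rw [mul_comm ((j : ℝ) + 1), mul_assoc, ← h3]
    simp only [multinomialSum, Finset.mul_sum]
    rw [Finset.sum_comm]
    refine Finset.sum_congr rfl fun i _ => Finset.sum_congr rfl fun l _ => ?_
    ring
  have hC : ∀ t ∈ Icc (0 : ℝ) 1, |G m t| ≤ m.factorial *
      (∑ l ∈ Finset.piAntidiag (Finset.univ : Finset (Fin d)) m, |b l|) * ‖h‖ ^ m := by
    intro t _
    simp only [G]
    rw [abs_mul, Nat.abs_cast, mul_assoc, Finset.sum_mul]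
    refine mul_le_mul_of_nonneg_left ?_ (Nat.cast_nonneg _)
    refine (Finset.abs_sum_le_sum_abs _ _).trans (Finset.sum_le_sum fun l hl => ?_)
    rw [mem_piAntidiag_univ] at hl
    have h1 : |(∏ i, h i ^ l i) / (multiFactorial l : ℝ)| ≤ ‖h‖ ^ m := by
      rw [abs_div, Nat.abs_cast, ← hl]
      refine (div_le_self (abs_nonneg _) ?_).trans (abs_prod_pow_le h l)
      exact Nat.one_le_cast.mpr (Nat.one_le_iff_ne_zero.mpr
        (Nat.cast_ne_zero.mp (multiFactorial_ne_zero l)))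
    rw [abs_mul, mul_comm |b l|]
    exact mul_le_mul h1 ((hb l hl _).trans (le_abs_self _)) (abs_nonneg _) (by positivity)
  have h0 := taylor_chain m hG hC (right_mem_Icc.mpr zero_le_one)
  have hG0 : G 0 1 = f (y + h) := by
    simp [G, multinomialSum, multiFactorial, multiDeriv_zero]
  rw [hG0] at h0
  convert h0 using 4 with j
  simp only [G, zero_smul, add_zero, one_pow, mul_one]
  rw [mul_div_cancel_left₀ _ (Nat.cast_ne_zero.mpr j.factorial_ne_zero)]

end Taylor

/-! ### Quasi-shuffle powers of the canonical letters -/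

namespace WordSpace

variable {A : Type*}

theorem append_word (a : A) (w : List A) : append a (word w) = word (w ++ [a]) := by
  simp [append, word]

theorem append_apply_nil (a : A) (y : WordSpace A) : append a y [] = 0 := by
  refine Finsupp.mapDomain_of_notMem_range _ _ ?_
  rintro ⟨w, hw⟩
  simp at hw

theorem append_apply [DecidableEq A] (a b : A) (y : WordSpace A) (u : List A) :
    append a y (u ++ [b]) = if a = b then y u else 0 := by
  split_ifs with h
  · subst h
    exact Finsupp.mapDomain_apply (List.append_left_injective [a]) y u
  · refine Finsupp.mapDomain_of_notMem_range _ _ ?_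
    rintro ⟨w, hw⟩
    simp only [List.append_singleton_inj] at hw
    exact h hw.2

theorem appendVec_apply_nil (x : A →₀ ℝ) (y : WordSpace A) : appendVec x y [] = 0 := by
  induction x using Finsupp.induction_linear with
  | zero => simp
  | add x x' h h' => simp [h, h']
  | single a r => simp [appendVec, append_apply_nil]

theorem appendVec_apply (x : A →₀ ℝ) (b : A) (y : WordSpace A) (u : List A) :
    appendVec x y (u ++ [b]) = x b * y u := by
  classical
  induction x using Finsupp.induction_linear with
  | zero => simp
  | add x x' h h' => simp [h, h', add_mul]
  | single a r => simp [appendVec, append_apply, Finsupp.single_apply]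

/-- The linear map that removes the last letter of the words ending with `b` and kills the
other words. -/
noncomputable def strip (b : A) : WordSpace A →ₗ[ℝ] WordSpace A :=
  Finsupp.lcomapDomain (fun w => w ++ [b]) (List.append_left_injective [b])

theorem strip_apply (b : A) (y : WordSpace A) (u : List A) : strip b y u = y (u ++ [b]) := rfl

end WordSpace

namespace GradedBracket

open WordSpace

variable {A : Type*} (B : GradedBracket A)

theorem quasiShuffle_word (v w : List A) :
    B.quasiShuffle (word v) (word w) = B.quasiShuffleWord v w := by
  simp [quasiShuffle, word]

theorem quasiShuffleWord_singleton_append (e b : A) (w : List A) :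
    B.quasiShuffleWord [e] (w ++ [b]) = word (w ++ [b] ++ [e]) + append b (B.quasiShuffleWord [e] w)
      + appendVec (B.bracket (Finsupp.single e 1) (Finsupp.single b 1)) (word w) := by
  have h := B.quasiShuffleWord_append [] w e b
  rwa [List.nil_append, quasiShuffleWord_nil_left, quasiShuffleWord_nil_left, append_word] at h

theorem quasiShuffle_letter_apply_nil (e : A) (z : WordSpace A) :
    B.quasiShuffle (word [e]) z [] = 0 := by
  induction z using Finsupp.induction_linear with
  | zero => simp
  | add x x' h h' => simp [h, h']
  | single w r =>
    have h1 : Finsupp.single w r = r • word w := by simp [word]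
    rw [h1, map_smul, Finsupp.smul_apply, quasiShuffle_word]
    rcases List.eq_nil_or_concat' w with rfl | ⟨w, b, rfl⟩
    · rw [quasiShuffleWord_nil_right]; simp [word]
    · rw [quasiShuffleWord_singleton_append, Finsupp.add_apply, Finsupp.add_apply,
        append_apply_nil, appendVec_apply_nil]
      simp [word]

/-- The coefficients of a quasi-shuffle product with a letter `e`: the last letter of a word is
the inserted letter, or untouched, or the merger of `e` with a letter. -/
theorem quasiShuffle_letter_apply [Fintype A] [DecidableEq A] (e b : A) (z : WordSpace A)
    (u : List A) :
    B.quasiShuffle (word [e]) z (u ++ [b]) = (if e = b then z u else 0)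
      + B.quasiShuffle (word [e]) (strip b z) u
      + ∑ c, B.bracket (Finsupp.single e 1) (Finsupp.single c 1) b * z (u ++ [c]) := by
  induction z using Finsupp.induction_linear with
  | zero => simp
  | add x x' h h' =>
    simp only [map_add, Finsupp.add_apply, h, h', mul_add, Finset.sum_add_distrib]
    split_ifs <;> ring
  | single w r =>
    have h1 : Finsupp.single w r = r • word w := by simp [word]
    simp only [h1, map_smul, Finsupp.smul_apply, smul_eq_mul, quasiShuffle_word, mul_left_comm _ r]
    rw [← Finset.mul_sum, ← mul_ite_zero, ← mul_add, ← mul_add]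
    congr 1
    rcases List.eq_nil_or_concat' w with rfl | ⟨w, c, rfl⟩
    · have h2 : strip b (word ([] : List A)) = 0 := by
        ext v; simp [strip_apply, word]
      rw [quasiShuffleWord_nil_right, h2]
      have h3 := append_apply e b (word []) u
      rw [append_word] at h3
      rw [← List.nil_append [e], h3]
      simp [word]
    · have h2 : strip b (word (w ++ [c])) = if c = b then word w else 0 := by
        ext v
        rw [strip_apply, ← append_word, append_apply]
        split_ifs <;> rfl
      rw [quasiShuffleWord_singleton_append, h2, ← append_word e, Finsupp.add_apply,
        Finsupp.add_apply, append_apply, append_apply, appendVec_apply]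
      congr 1
      · congr 1
        split_ifs
        · rw [quasiShuffle_word]
        · simp
      · rw [Finset.sum_eq_single c]
        · rw [← append_word, append_apply, if_pos rfl]
        · intro c' _ hc
          rw [← append_word, append_apply, if_neg (Ne.symm hc), mul_zero]
        · simp

end GradedBracket

namespace MultiIndexLetter

open WordSpace GradedBracket

variable {d N : ℕ}

/-- The sum of the letters of a word, a multi-index. -/
def wordSum (w : List (MultiIndexLetter d N)) : Fin d → ℕ := (w.map Subtype.val).sum

/-- The product of the factorials of the letters of a word. -/
def wordFactorial (w : List (MultiIndexLetter d N)) : ℕ :=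
  (w.map fun k => multiFactorial k.1).prod

theorem wordSum_append (v w : List (MultiIndexLetter d N)) :
    wordSum (v ++ w) = wordSum v + wordSum w := by simp [wordSum]

theorem wordSum_singleton (k : MultiIndexLetter d N) : wordSum [k] = k.1 := by simp [wordSum]

theorem wordFactorial_append (v w : List (MultiIndexLetter d N)) :
    wordFactorial (v ++ w) = wordFactorial v * wordFactorial w := by simp [wordFactorial]

theorem wordFactorial_singleton (k : MultiIndexLetter d N) :
    wordFactorial [k] = multiFactorial k.1 := by simp [wordFactorial]

theorem wordFactorial_ne_zero (w : List (MultiIndexLetter d N)) : (wordFactorial w : ℝ) ≠ 0 := by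
  induction w with
  | nil => simp [wordFactorial]
  | cons k w ih =>
    have h : k :: w = [k] ++ w := rfl
    rw [h, wordFactorial_append, wordFactorial_singleton, Nat.cast_mul]
    exact mul_ne_zero (multiFactorial_ne_zero _) ih

theorem sum_wordSum (w : List (MultiIndexLetter d N)) :
    ∑ i, wordSum w i = (gradedBracket d N).weight w := by
  induction w with
  | nil => simp [wordSum, weight_nil]
  | cons k w ih =>
    have h : k :: w = [k] ++ w := rfl
    rw [h, wordSum_append, weight_append, ← ih, weight_singleton, wordSum_singleton]
    simp only [Pi.add_apply, Finset.sum_add_distrib]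
    rfl

theorem wordSum_eq_zero {w : List (MultiIndexLetter d N)} : wordSum w = 0 ↔ w = [] := by
  constructor
  · intro h
    have h1 := sum_wordSum w
    have h2 := (gradedBracket d N).length_le_weight w
    rw [h] at h1
    simp only [Pi.zero_apply, Finset.sum_const_zero] at h1
    exact List.length_eq_zero_iff.mp (by omega)
  · rintro rfl; rfl

theorem letterBracket_apply (α β b : MultiIndexLetter d N) :
    letterBracket α β b = if α.1 + β.1 = b.1 then 1 else 0 := by
  classical
  rw [letterBracket]
  split_ifs with h h1 h1
  · rw [Finsupp.single_apply, if_pos (Subtype.ext h1)]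
  · rw [Finsupp.single_apply, if_neg]
    intro h2
    exact h1 (congrArg Subtype.val h2)
  · exfalso
    have h2 := sum_add_degree α β
    rw [h1] at h2
    exact h (h2.symm.trans_le b.2.2)
  · rfl

/-- The part of the coefficient of `u b` in `e_i ⋆ ∑_{Σ w = l} w / w!` in which the last letter `b`
is the inserted letter `e_i` or a merger `k + e_i`. Both cases give the numerator `b i`. -/
theorem sum_letterBracket_basis (hN : 1 ≤ N) (i : Fin d) (l : Fin d → ℕ) (c : ℝ)
    {z : WordSpace (MultiIndexLetter d N)}
    (hz : ∀ w, z w = if wordSum w = l then c / wordFactorial w else 0)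
    (u : List (MultiIndexLetter d N)) (b : MultiIndexLetter d N) [Decidable (basis hN i = b)] :
    (if basis hN i = b then z u else 0)
        + ∑ k, letterBracket (basis hN i) k b * z (u ++ [k]) =
      if wordSum u + b.1 = l + Pi.single i 1 then
        c * (b.1 i : ℝ) / (wordFactorial u * multiFactorial b.1) else 0 := by
  classical
  have hterm : ∀ k, letterBracket (basis hN i) k b * z (u ++ [k]) =
      if k.1 + Pi.single i 1 = b.1 then
        (if wordSum u + b.1 = l + Pi.single i 1 then
          c * (b.1 i : ℝ) / (wordFactorial u * multiFactorial b.1) else 0) else 0 := by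
    intro k
    rw [letterBracket_apply, ite_mul, one_mul, zero_mul,
      show (basis hN i).1 = Pi.single i 1 from rfl, add_comm (Pi.single i 1) k.1]
    refine ite_congr rfl (fun h => ?_) fun _ => rfl
    rw [hz, wordSum_append, wordSum_singleton, wordFactorial_append, wordFactorial_singleton, ← h,
      multiFactorial_add_single]
    refine ite_congr (by rw [← add_assoc, add_left_inj]) (fun _ => ?_) fun _ => rfl
    have := multiFactorial_ne_zero k.1
    have := wordFactorial_ne_zero u
    simp only [Pi.add_apply, Pi.single_eq_same]
    push_cast
    field_simp
  rw [Finset.sum_congr rfl fun k _ => hterm k]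
  by_cases hb : basis hN i = b
  · rw [if_pos hb, Finset.sum_eq_zero, add_zero, hz, ← hb,
      show (basis hN i).1 = Pi.single i 1 from rfl]
    · refine ite_congr (by rw [add_left_inj]) (fun _ => ?_) fun _ => rfl
      have h1 := multiFactorial_add_single (0 : Fin d → ℕ) i
      rw [zero_add] at h1
      rw [h1]
      simp [multiFactorial]
    · intro k _
      rw [if_neg]
      intro h
      rw [← hb, show (basis hN i).1 = Pi.single i 1 from rfl] at h
      exact k.2.1 (by simpa using h)
  · rw [if_neg hb, zero_add]
    by_cases hbi : b.1 i = 0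
    · simp [hbi]
    · have hbe : b.1 - Pi.single i 1 + Pi.single i 1 = b.1 := by
        funext j
        by_cases hj : j = i
        · subst hj; simp; omega
        · simp [hj]
      have hne : b.1 - Pi.single i 1 ≠ 0 := by
        intro h
        rw [h, zero_add] at hbe
        exact hb (Subtype.ext hbe)
      have hle : ∑ j, (b.1 - Pi.single i 1 : Fin d → ℕ) j ≤ N :=
        (Finset.sum_le_sum fun j _ => Nat.sub_le _ _).trans b.2.2
      rw [Finset.sum_eq_single ⟨b.1 - Pi.single i 1, hne, hle⟩, if_pos hbe]
      · intro k _ hk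
        rw [if_neg]
        intro h
        exact hk (Subtype.ext (add_right_cancel (h.trans hbe.symm)))
      · simp

/-- Multiplication by `e_i` maps `∑_{Σ w = l} w / w!` to `(l_i + 1) ∑_{Σ w = l + e_i} w / w!`,
where `w!` is the product of the factorials of the letters. -/
theorem quasiShuffle_basis_apply (hN : 1 ≤ N) (i : Fin d) (l : Fin d → ℕ) (c : ℝ)
    {z : WordSpace (MultiIndexLetter d N)}
    (hz : ∀ w, z w = if wordSum w = l then c / wordFactorial w else 0)
    (u : List (MultiIndexLetter d N)) :
    (gradedBracket d N).quasiShuffle (word [basis hN i]) z u =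
      if wordSum u = l + Pi.single i 1 then c * (l i + 1) / wordFactorial u else 0 := by
  classical
  induction u using List.reverseRecOn generalizing z l c with
  | nil =>
    rw [quasiShuffle_letter_apply_nil, if_neg]
    intro h
    have := congrFun h i
    simp [wordSum] at this
  | append_singleton u b ih =>
    rw [quasiShuffle_letter_apply, add_right_comm]
    have hbr : ∀ k, (gradedBracket d N).bracket (Finsupp.single (basis hN i) 1)
        (Finsupp.single k 1) = letterBracket (basis hN i) k := bilinBracket_single _
    simp only [hbr]
    rw [sum_letterBracket_basis hN i l c hz]
    -- The contribution of an untouched last letter `b`; together with `b i` above, its numerator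
    -- `l i + 1 - b i` adds up to `l i + 1`.
    have h2 : (gradedBracket d N).quasiShuffle (word [basis hN i]) (strip b z) u =
        if wordSum u + b.1 = l + Pi.single i 1 then
          c * (l i + 1 - b.1 i : ℝ) / (wordFactorial u * multiFactorial b.1) else 0 := by
      by_cases hbl : b.1 ≤ l
      · rw [ih (l - b.1) (c / multiFactorial b.1)]
        · have hiff : wordSum u = l - b.1 + Pi.single i 1 ↔
              wordSum u + b.1 = l + Pi.single i 1 := by
            rw [← add_left_inj b.1, add_right_comm, tsub_add_cancel_of_le hbl]
          simp only [hiff, Pi.sub_apply, Nat.cast_sub (hbl i)]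
          refine ite_congr rfl (fun _ => ?_) fun _ => rfl
          have := multiFactorial_ne_zero b.1
          have := wordFactorial_ne_zero u
          field_simp
          ring
        · intro w
          have hiff : wordSum w = l - b.1 ↔ wordSum w + b.1 = l := by
            rw [← add_left_inj b.1, tsub_add_cancel_of_le hbl]
          rw [strip_apply, hz, wordSum_append, wordFactorial_append, wordSum_singleton,
            wordFactorial_singleton]
          simp only [hiff]
          refine ite_congr rfl (fun _ => ?_) fun _ => rfl
          rw [div_div, mul_comm]
          push_cast
          rfl
      · have h0 : strip b z = 0 := by
          ext w
          rw [strip_apply, hz, if_neg]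
          · rfl
          · rintro rfl
            rw [wordSum_append, wordSum_singleton] at hbl
            exact hbl le_add_self
        rw [h0]
        simp only [map_zero, Finsupp.coe_zero, Pi.zero_apply]
        symm
        split_ifs with h
        · -- Only the `i`-th entry of `b` can exceed that of `l`, and then by exactly one.
          have hbi : b.1 i = l i + 1 := by
            by_contra hcon
            refine hbl fun j => ?_
            have hj : wordSum u j + b.1 j = l j + (Pi.single i 1 : Fin d → ℕ) j := congrFun h j
            change b.1 j ≤ l j
            by_cases hji : j = i
            · subst hji
              rw [Pi.single_eq_same] at hj
              omega
            · rw [Pi.single_eq_of_ne hji] at hj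
              omega
          rw [hbi]
          simp
        · rfl
    rw [h2, wordSum_append, wordFactorial_append, wordSum_singleton, wordFactorial_singleton]
    split_ifs
    · rw [← add_div]
      push_cast
      congr 1
      ring
    · simp

/-- The quasi-shuffle product of the canonical letters with indices in a list. -/
noncomputable def basisProduct (hN : 1 ≤ N) (L : List (Fin d)) : WordSpace (MultiIndexLetter d N) :=
  L.foldr (fun i z => (gradedBracket d N).quasiShuffle (word [basis hN i]) z) (word [])

theorem monomial_eq_basisProduct (hN : 1 ≤ N) (l : Fin d → ℕ) :
    (gradedBracket d N).monomial (fun i => word [basis hN i]) l =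
      basisProduct hN (indexList l) := by
  have h : ((List.finRange d).flatMap fun i => List.replicate (l i) (word [basis hN i])) =
      (indexList l).map fun i => word [basis hN i] := by
    rw [indexList, List.map_flatMap]
    simp only [List.map_replicate]
  rw [monomial, h, List.foldr_map, basisProduct]

/-- `e_1^{l_1} ⋆ ⋯ ⋆ e_d^{l_d} = ∑_{Σ w = l} (l! / w!) w`. -/
theorem basisProduct_apply (hN : 1 ≤ N) (L : List (Fin d)) (u : List (MultiIndexLetter d N)) :
    basisProduct hN L u = if wordSum u = fun i => L.count i then
      (multiFactorial fun i => L.count i : ℝ) / wordFactorial u else 0 := by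
  classical
  induction L generalizing u with
  | nil =>
    have h0 : (fun i : Fin d => ([] : List (Fin d)).count i) = 0 := rfl
    simp only [h0, wordSum_eq_zero, basisProduct, List.foldr_nil]
    split_ifs with h
    · subst h
      simp [word, multiFactorial, wordFactorial]
    · simp [word, h]
  | cons i L ih =>
    have hc : (fun j => (i :: L).count j) = (fun j => L.count j) + Pi.single i 1 := by
      funext j
      by_cases hj : j = i
      · subst hj; simp
      · simp [hj, Ne.symm hj]
    rw [hc, multiFactorial_add_single]
    refine (quasiShuffle_basis_apply hN i _ _ ih u).trans ?_
    refine ite_congr rfl (fun _ => ?_) fun _ => rfl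
    push_cast
    ring

theorem basisProduct_indexList_apply (hN : 1 ≤ N) (l : Fin d → ℕ)
    (u : List (MultiIndexLetter d N)) :
    basisProduct hN (indexList l) u =
      if wordSum u = l then (multiFactorial l : ℝ) / wordFactorial u else 0 := by
  simp only [basisProduct_apply, count_indexList]

theorem basisProduct_mem_truncated (hN : 1 ≤ N) {L : List (Fin d)} {n : ℕ} (hL : L.length ≤ n) :
    basisProduct hN L ∈ (gradedBracket d N).truncated n := by
  refine (Finsupp.mem_supported ℝ _).mpr fun u hu => ?_
  rw [Finset.mem_coe, Finsupp.mem_support_iff, basisProduct_apply] at hu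
  have h : wordSum u = fun i => L.count i := by
    by_contra h
    exact hu (if_neg h)
  rw [Set.mem_ofPred_eq, ← sum_wordSum, h]
  have hc := Multiset.sum_count_eq_card (s := Finset.univ) (m := (L : Multiset (Fin d)))
    (fun a _ => Finset.mem_univ a)
  simp only [Multiset.coe_count, Multiset.coe_card] at hc
  exact hc.trans_le hL

end MultiIndexLetter

/-! ### The lifted derivatives and the change of variable formula -/

theorem IsHolder.exists_norm_sub_le {E : Type*} [SeminormedAddCommGroup E] {γ T : ℝ} {f : ℝ → E}
    (hγ : 0 ≤ γ) (hf : IsHolder γ T f) :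
    ∃ C : ℝ, 0 ≤ C ∧ ∀ s ∈ Icc 0 T, ∀ t ∈ Icc 0 T, ‖f t - f s‖ ≤ C * |t - s| ^ γ := by
  obtain ⟨C, hC⟩ := hf
  refine ⟨C, C.2, fun s hs t ht => ?_⟩
  have := hC.dist_le ht hs
  rwa [dist_eq_norm, Real.dist_eq, Real.coe_toNNReal _ hγ] at this

theorem LipschitzWith.isHolder_comp {E F : Type*} [PseudoEMetricSpace E] [PseudoEMetricSpace F]
    {γ T : ℝ} {f : ℝ → E} {g : E → F} {K : ℝ≥0} (hg : LipschitzWith K g) (hf : IsHolder γ T f) :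
    IsHolder γ T (fun t => g (f t)) := by
  obtain ⟨C, hC⟩ := hf
  have h := (holderWith_one.mpr hg).comp_holderOnWith hC
  rw [one_mul] at h
  exact ⟨_, h⟩

section MultiDeriv

variable {d n : ℕ} {f : EuclideanSpace ℝ (Fin d) → ℝ}

/-- Taylor's formula for a partial derivative of a function of class `C_b^n`. -/
theorem IsCb.exists_taylor_bound_multiDeriv (hf : IsCb n f) {k : Fin d → ℕ} {m : ℕ}
    (hk : m + ∑ i, k i ≤ n) :
    ∃ C : ℝ, 0 ≤ C ∧ ∀ y h : EuclideanSpace ℝ (Fin d), |multiDeriv k f (y + h) -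
      ∑ j ∈ Finset.range m, multinomialSum h j (fun l => multiDeriv (k + l) f y)|
        ≤ C * ‖h‖ ^ m := by
  have hkl : ∀ l : Fin d → ℕ, ∑ i, l i ≤ m →
      multiDeriv l (multiDeriv k f) = multiDeriv (k + l) f ∧ ∑ i, (k + l) i ≤ n := by
    intro l hl
    have h1 : ∑ i, (k + l) i ≤ n := by
      simp only [Pi.add_apply, Finset.sum_add_distrib]
      omega
    exact ⟨multiDeriv_multiDeriv k l (hf.1.of_le (by exact_mod_cast h1)), h1⟩
  obtain ⟨C, hC, h⟩ := exists_taylor_bound (m := m) (f := multiDeriv k f)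
    (contDiff_multiDeriv k (hf.1.of_le (by exact_mod_cast hk))) (fun l hl => by
      rw [(hkl l hl.le).1]
      exact hf.2 _ (hkl l hl.le).2)
  refine ⟨C, hC, fun y v => ?_⟩
  convert h y v using 4 with j hj
  refine Finset.sum_congr rfl fun l hl => ?_
  rw [mem_piAntidiag_univ] at hl
  rw [Finset.mem_range] at hj
  simp only [(hkl l (by omega)).1]

theorem multinomialSum_zero (h : Fin d → ℝ) (F : (Fin d → ℕ) → ℝ) :
    multinomialSum h 0 F = F 0 := by
  simp [multinomialSum, multiFactorial]

theorem IsCb.exists_lipschitzWith_multiDeriv (hf : IsCb n f) {k : Fin d → ℕ}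
    (hk : ∑ i, k i < n) : ∃ K : ℝ≥0, LipschitzWith K (multiDeriv k f) := by
  obtain ⟨C, hC, h⟩ := hf.exists_taylor_bound_multiDeriv (k := k) (m := 1) (by omega)
  refine ⟨⟨C, hC⟩, LipschitzWith.of_dist_le_mul fun y z => ?_⟩
  have h1 := h z (y - z)
  rw [Finset.sum_range_one, multinomialSum_zero, add_zero, pow_one, add_sub_cancel] at h1
  rw [Real.dist_eq, dist_eq_norm]
  exact h1

end MultiDeriv

namespace MultiIndexLetter

open WordSpace GradedBracket

variable {d : ℕ} {γ T : ℝ} {x : ℝ → EuclideanSpace ℝ (Fin d)}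
  {X : ℝ → ℝ → Module.Dual ℝ (WordSpace (MultiIndexLetter d (roughLevel γ)))}

/-- A rough path maps `e_1^{l_1} ⋆ ⋯ ⋆ e_d^{l_d}` to the monomial of the increment of `x`. -/
theorem apply_basisProduct (hN : 1 ≤ roughLevel γ)
    (hX : (gradedBracket d (roughLevel γ)).IsQuasiGeometricRoughPath γ T X)
    (hXx : ∀ i : Fin d, ∀ s ∈ Icc 0 T, ∀ t ∈ Icc 0 T, X s t (word [basis hN i]) = x t i - x s i)
    {s t : ℝ} (hs : s ∈ Icc 0 T) (ht : t ∈ Icc 0 T) (L : List (Fin d))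
    (hL : L.length ≤ roughLevel γ) :
    X s t (basisProduct hN L) = (L.map fun i => (x t - x s) i).prod := by
  induction L with
  | nil => simpa [basisProduct] using hX.unit s hs t ht
  | cons i L ih =>
    rw [List.length_cons] at hL
    have hmem := basisProduct_mem_truncated hN (L := i :: L) (n := roughLevel γ) (by simpa using hL)
    rw [List.map_cons, List.prod_cons, ← ih (by omega), PiLp.sub_apply, ← hXx i s hs t ht]
    refine hX.mul s hs t ht _ ?_ _ (basisProduct_mem_truncated hN (by omega)) hmem
    refine word_mem_truncated _ ?_
    rw [← sum_wordSum, wordSum_singleton]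
    simpa [basis] using hN

theorem prod_map_indexList (l : Fin d → ℕ) (h : Fin d → ℝ) :
    ((indexList l).map h).prod = ∏ i, h i ^ l i := by
  rw [Finset.prod_list_map_count]
  rw [Finset.prod_subset (Finset.subset_univ _) fun i _ hi => ?_]
  · simp only [count_indexList]
  · rw [List.mem_toFinset] at hi
    rw [List.count_eq_zero_of_not_mem hi, pow_zero]

/-- The signature of `x` in multi-index form: `∑_{Σ v = l} X(v) / v! = (x_t - x_s)^l / l!`. -/
theorem sum_wordSum_eq (hN : 1 ≤ roughLevel γ)
    (hX : (gradedBracket d (roughLevel γ)).IsQuasiGeometricRoughPath γ T X)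
    (hXx : ∀ i : Fin d, ∀ s ∈ Icc 0 T, ∀ t ∈ Icc 0 T, X s t (word [basis hN i]) = x t i - x s i)
    {s t : ℝ} (hs : s ∈ Icc 0 T) (ht : t ∈ Icc 0 T) {n : ℕ} (hn : n ≤ roughLevel γ)
    {l : Fin d → ℕ} (hl : ∑ i, l i ≤ n) :
    ∑ v ∈ (gradedBracket d (roughLevel γ)).words n with wordSum v = l,
        X s t (word v) / wordFactorial v =
      (∏ i, (x t - x s) i ^ l i) / multiFactorial l := by
  have h := apply_basisProduct hN hX hXx hs ht (indexList l) (by rw [length_indexList]; omega)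
  rw [prod_map_indexList, dual_apply_eq_sum _ _
    ((gradedBracket d (roughLevel γ)).words n |>.filter fun v => wordSum v = l)] at h
  · rw [eq_div_iff (multiFactorial_ne_zero l), ← h, Finset.sum_mul]
    refine Finset.sum_congr rfl fun v hv => ?_
    rw [basisProduct_indexList_apply, if_pos (Finset.mem_filter.mp hv).2]
    ring
  · intro w hw
    rw [basisProduct_indexList_apply, if_neg]
    intro hwl
    refine hw (Finset.mem_filter.mpr ⟨?_, hwl⟩)
    rw [mem_words, ← sum_wordSum, hwl]
    exact hl

/-- Sums over words of functions of `Σ v`, weighted by the rough path, are sums over multi-indices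
weighted by the monomials of the increment of `x`. -/
theorem sum_words_eq_multinomialSum (hN : 1 ≤ roughLevel γ)
    (hX : (gradedBracket d (roughLevel γ)).IsQuasiGeometricRoughPath γ T X)
    (hXx : ∀ i : Fin d, ∀ s ∈ Icc 0 T, ∀ t ∈ Icc 0 T, X s t (word [basis hN i]) = x t i - x s i)
    {s t : ℝ} (hs : s ∈ Icc 0 T) (ht : t ∈ Icc 0 T) {n : ℕ} (hn : n ≤ roughLevel γ)
    (F : (Fin d → ℕ) → ℝ) :
    ∑ v ∈ (gradedBracket d (roughLevel γ)).words n,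
        F (wordSum v) / wordFactorial v * X s t (word v) =
      ∑ j ∈ Finset.range (n + 1), multinomialSum (x t - x s) j F := by
  set W := (gradedBracket d (roughLevel γ)).words n with hW
  have hmaps : ∀ v ∈ W, wordSum v ∈ (Finset.range (n + 1)).biUnion
      fun j => Finset.piAntidiag (Finset.univ : Finset (Fin d)) j := by
    intro v hv
    rw [hW, mem_words, ← sum_wordSum] at hv
    exact Finset.mem_biUnion.mpr
      ⟨_, Finset.mem_range.mpr (Nat.lt_succ_of_le hv), mem_piAntidiag_univ.mpr rfl⟩
  rw [← Finset.sum_fiberwise_of_maps_to hmaps, Finset.sum_biUnion]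
  · refine Finset.sum_congr rfl fun j hj => Finset.sum_congr rfl fun l hl => ?_
    rw [Finset.mem_range] at hj
    rw [mem_piAntidiag_univ] at hl
    rw [← sum_wordSum_eq hN hX hXx hs ht hn (l := l) (by omega), Finset.sum_mul]
    refine Finset.sum_congr rfl fun v hv => ?_
    rw [(Finset.mem_filter.mp hv).2]
    ring
  · intro j _ j' _ hne
    refine Finset.disjoint_left.mpr fun l hl hl' => hne ?_
    rw [← mem_piAntidiag_univ.mp hl, mem_piAntidiag_univ.mp hl']

end MultiIndexLetter

section ChangeOfVariable

open MultiIndexLetter WordSpace GradedBracket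

variable {d : ℕ} {γ T : ℝ} {x : ℝ → EuclideanSpace ℝ (Fin d)}
  {X : ℝ → ℝ → Module.Dual ℝ (WordSpace (MultiIndexLetter d (roughLevel γ)))}
  {φ : EuclideanSpace ℝ (Fin d) → ℝ}

/-- The coefficients of `∂^k Φ(X_r)`: the word `u` has the coefficient
`∂^{Σ u} (∂^k φ)(x_r) / u!`. -/
theorem derivLift_apply (hγ : γ ∈ Ioo (0 : ℝ) 1) (hφ : IsCb (roughLevel γ + 1) φ)
    (k : MultiIndexLetter d (roughLevel γ)) {n : ℕ} (hn : n + k.degree = roughLevel γ) (r : ℝ)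
    (u : List (MultiIndexLetter d (roughLevel γ))) :
    derivLift hγ x φ k r u =
      if (gradedBracket d (roughLevel γ)).weight u ≤ n then
        multiDeriv (k.1 + wordSum u) φ (x r) / wordFactorial u else 0 := by
  have hM : roughLevel γ + 1 - k.degree = n + 1 := by omega
  have h0 : ∀ i, dualWord [] (coordinateLift (one_le_roughLevel hγ) x r i) = x r i := by
    intro i
    simp [coordinateLift, dualWord, word]
  have h1 : ∀ i, coordinateLift (one_le_roughLevel hγ) x r i - x r i • word [] =
      word [basis (one_le_roughLevel hγ) i] := by
    intro i
    rw [coordinateLift, add_sub_cancel_left]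
  have hproj : ∀ (h : WordSpace (MultiIndexLetter d (roughLevel γ))),
      (gradedBracket d (roughLevel γ)).projLT (n + 1) h u =
        if (gradedBracket d (roughLevel γ)).weight u ≤ n then h u else 0 := by
    intro h
    rw [projLT, Finsupp.filter_apply]
    simp only [Nat.lt_succ_iff]
  rw [derivLift, hM, lift, Finsupp.finsetSum_apply]
  simp only [Finsupp.finsetSum_apply, Finsupp.smul_apply, h1, h0, hproj,
    monomial_eq_basisProduct, basisProduct_indexList_apply, smul_eq_mul, mul_ite, mul_zero]
  split_ifs with hu
  · rw [← sum_wordSum] at hu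
    rw [Finset.sum_eq_single (∑ i, wordSum u i), Finset.sum_eq_single (wordSum u), if_pos rfl,
      multiDeriv_multiDeriv]
    · have := multiFactorial_ne_zero (wordSum u)
      field_simp
    · refine hφ.1.of_le ?_
      have h2 : ∑ i, (k.1 + wordSum u) i = k.degree + ∑ i, wordSum u i := by
        simp [Finset.sum_add_distrib, degree]
      rw [h2]
      exact_mod_cast (by omega)
    · intro l _ hl
      rw [if_neg (Ne.symm hl)]
    · intro h
      exact absurd (mem_piAntidiag_univ.mpr rfl) h
    · intro j _ hj
      refine Finset.sum_eq_zero fun l hl => ?_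
      rw [if_neg]
      rintro rfl
      exact hj (mem_piAntidiag_univ.mp hl).symm
    · intro h
      exact absurd (Finset.mem_range.mpr (Nat.lt_succ_of_le hu)) h
  · simp

/-- At a word `u` the remainder of `∂^k Φ(X)` is a Taylor remainder of `∂^{k + Σ u} φ`. -/
theorem isControlled_derivLift (hγ : γ ∈ Ioo (0 : ℝ) 1) (hx : IsHolder γ T x)
    (hX : (gradedBracket d (roughLevel γ)).IsQuasiGeometricRoughPath γ T X)
    (hXx : ∀ i : Fin d, ∀ s ∈ Icc 0 T, ∀ t ∈ Icc 0 T,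
      X s t (word [basis (one_le_roughLevel hγ) i]) = x t i - x s i)
    (hφ : IsCb (roughLevel γ + 1) φ) (k : MultiIndexLetter d (roughLevel γ)) {n : ℕ}
    (hn : n + k.degree = roughLevel γ) :
    (gradedBracket d (roughLevel γ)).IsControlled γ T X (n + 1) (derivLift hγ x φ k) := by
  have hdeg : ∀ u : List (MultiIndexLetter d (roughLevel γ)),
      ∑ i, (k.1 + wordSum u) i = k.degree + (gradedBracket d (roughLevel γ)).weight u := by
    intro u
    rw [← sum_wordSum]
    simp [Finset.sum_add_distrib, degree]
  refine ⟨fun t _ u hu => ?_, fun u hu => ?_, fun u hu => ?_⟩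
  · rw [dualWord_apply, derivLift_apply hγ hφ k hn, if_neg (by omega)]
  · simp only [dualWord_apply, derivLift_apply hγ hφ k hn,
      if_pos (Nat.lt_succ_iff.mp hu)]
    obtain ⟨K, hK⟩ := hφ.exists_lipschitzWith_multiDeriv (k := k.1 + wordSum u)
      (by rw [hdeg]; omega)
    have h1 := (lipschitzWith_smul ((wordFactorial u : ℝ)⁻¹)).comp hK
    have h2 := h1.isHolder_comp hx
    simpa [div_eq_inv_mul] using h2
  · have hu' := Nat.lt_succ_iff.mp hu
    set m := n - (gradedBracket d (roughLevel γ)).weight u with hm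
    obtain ⟨C, hC, hT⟩ := hφ.exists_taylor_bound_multiDeriv (k := k.1 + wordSum u) (m := m + 1)
      (by rw [hdeg]; omega)
    obtain ⟨D, hD, hH⟩ := hx.exists_norm_sub_le hγ.1.le
    refine ⟨C * D ^ (m + 1), fun s hs t ht _ => ?_⟩
    rw [(gradedBracket d (roughLevel γ)).convolution_dualWord (n := n) _ _ (fun w hw => by
        rw [derivLift_apply hγ hφ k hn, if_neg (by omega)]) hu', dualWord_apply, ← hm]
    have hsum : ∑ v ∈ (gradedBracket d (roughLevel γ)).words m,
          derivLift hγ x φ k s (v ++ u) * X s t (word v) =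
        (∑ j ∈ Finset.range (m + 1), multinomialSum (x t - x s) j
          fun l => multiDeriv (k.1 + wordSum u + l) φ (x s)) / wordFactorial u := by
      rw [← sum_words_eq_multinomialSum (one_le_roughLevel hγ) hX hXx hs ht (by omega),
        Finset.sum_div]
      refine Finset.sum_congr rfl fun v hv => ?_
      rw [mem_words] at hv
      rw [derivLift_apply hγ hφ k hn, if_pos (by rw [weight_append]; omega), wordSum_append,
        wordFactorial_append, add_comm (wordSum v), add_assoc]
      have := wordFactorial_ne_zero u
      have := wordFactorial_ne_zero v
      push_cast
      field_simp
    rw [hsum, derivLift_apply hγ hφ k hn, if_pos hu', ← sub_div, abs_div, Nat.abs_cast]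
    refine (div_le_self (abs_nonneg _) (Nat.one_le_cast.mpr (Nat.one_le_iff_ne_zero.mpr
      (Nat.cast_ne_zero.mp (wordFactorial_ne_zero u))))).trans ?_
    have h1 := hT (x s) (x t - x s)
    rw [add_sub_cancel] at h1
    refine h1.trans ?_
    rw [mul_assoc]
    refine mul_le_mul_of_nonneg_left ?_ hC
    refine (pow_le_pow_left₀ (norm_nonneg _) (hH s hs t ht) _).trans_eq ?_
    have hexp : ((n + 1 : ℕ) : ℝ) - ((gradedBracket d (roughLevel γ)).weight u : ℝ) =
        ((m + 1 : ℕ) : ℝ) := by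
      rw [← Nat.cast_sub hu.le]
      congr 1
      omega
    rw [mul_pow, hexp, mul_comm ((m + 1 : ℕ) : ℝ) γ, Real.rpow_mul (abs_nonneg _),
      Real.rpow_natCast]

/-- Each nonempty word is `v k` for a unique word `v` and a unique letter `k`. -/
theorem sum_letters_sum_words {N : ℕ} (f : List (MultiIndexLetter d N) → ℝ) :
    ∑ k : MultiIndexLetter d N, ∑ v ∈ (gradedBracket d N).words (N - k.degree), f (v ++ [k]) =
      ∑ w ∈ (gradedBracket d N).words N, f w - f [] := by
  classical
  have hnil : [] ∈ (gradedBracket d N).words N := by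
    rw [mem_words]; exact Nat.zero_le _
  rw [← Finset.add_sum_erase _ _ hnil, add_sub_cancel_left, Finset.sum_sigma']
  have hw : ∀ (v : List (MultiIndexLetter d N)) (k : MultiIndexLetter d N),
      (gradedBracket d N).weight (v ++ [k]) = (gradedBracket d N).weight v + k.degree := by
    intro v k
    rw [weight_append, weight_singleton]
    rfl
  refine Finset.sum_bij (fun p _ => p.2 ++ [p.1]) ?_ ?_ ?_ ?_
  · rintro ⟨k, v⟩ h
    simp only [Finset.mem_sigma, Finset.mem_univ, true_and, mem_words] at h
    have hk : k.degree ≤ N := k.2.2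
    simp only [Finset.mem_erase, mem_words, hw]
    exact ⟨by simp, by omega⟩
  · rintro ⟨k, v⟩ _ ⟨k', v'⟩ _ h
    obtain ⟨rfl, h2⟩ := List.append_inj' h rfl
    obtain rfl := List.singleton_injective h2
    rfl
  · intro w h
    rw [Finset.mem_erase, mem_words] at h
    rcases List.eq_nil_or_concat' w with rfl | ⟨v, k, rfl⟩
    · exact absurd rfl h.1
    · refine ⟨⟨k, v⟩, ?_, rfl⟩
      rw [hw] at h
      simp only [Finset.mem_sigma, Finset.mem_univ, true_and, mem_words]
      omega
  · rintro ⟨k, v⟩ _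
    rfl

/-- The germs of the rough integrals sum up to the Taylor polynomial of `φ`. -/
theorem sum_integralGerm_derivLift (hγ : γ ∈ Ioo (0 : ℝ) 1)
    (hX : (gradedBracket d (roughLevel γ)).IsQuasiGeometricRoughPath γ T X)
    (hXx : ∀ i : Fin d, ∀ s ∈ Icc 0 T, ∀ t ∈ Icc 0 T,
      X s t (word [basis (one_le_roughLevel hγ) i]) = x t i - x s i)
    (hφ : IsCb (roughLevel γ + 1) φ) {s t : ℝ} (hs : s ∈ Icc 0 T) (ht : t ∈ Icc 0 T) :
    ∑ k : MultiIndexLetter d (roughLevel γ), 1 / (multiFactorial k.1 : ℝ) *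
        (gradedBracket d (roughLevel γ)).integralGerm γ X (derivLift hγ x φ k) k s t =
      ∑ j ∈ Finset.range (roughLevel γ + 1), multinomialSum (x t - x s) j
        (fun l => multiDeriv l φ (x s)) - multiDeriv 0 φ (x s) := by
  rw [← sum_words_eq_multinomialSum (one_le_roughLevel hγ) hX hXx hs ht le_rfl]
  have h := sum_letters_sum_words (d := d) (N := roughLevel γ)
    fun w => multiDeriv (wordSum w) φ (x s) / wordFactorial w * X s t (word w)
  have hnil : multiDeriv (wordSum ([] : List (MultiIndexLetter d (roughLevel γ)))) φ (x s) /
      wordFactorial ([] : List (MultiIndexLetter d (roughLevel γ))) * X s t (word []) =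
        multiDeriv 0 φ (x s) := by
    rw [hX.unit s hs t ht, wordSum_eq_zero.mpr rfl]
    simp [wordFactorial]
  rw [hnil] at h
  rw [← h]
  refine Finset.sum_congr rfl fun k _ => ?_
  have hk : roughLevel γ - k.degree + k.degree = roughLevel γ := Nat.sub_add_cancel k.2.2
  rw [integralGerm_eq_sum hk (fun w hw => by
    rw [derivLift_apply hγ hφ k hk, if_neg (by omega)]), Finset.mul_sum]
  refine Finset.sum_congr rfl fun v hv => ?_
  rw [mem_words] at hv
  rw [derivLift_apply hγ hφ k hk, if_pos hv, wordSum_append, wordSum_singleton,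
    wordFactorial_append, wordFactorial_singleton, add_comm k.1]
  push_cast
  have := multiFactorial_ne_zero k.1
  have := wordFactorial_ne_zero v
  field_simp

end ChangeOfVariable

theorem mainTheorem2 (d : ℕ) (hd : 1 ≤ d) (γ : ℝ) (hγ : γ ∈ Set.Ioo (0 : ℝ) 1)
    (T : ℝ) (hT : 0 < T)
    (x : ℝ → EuclideanSpace ℝ (Fin d)) (hx : IsHolder γ T x)
    (X : ℝ → ℝ → Module.Dual ℝ (WordSpace (MultiIndexLetter d (roughLevel γ))))
    (hX : (MultiIndexLetter.gradedBracket d (roughLevel γ)).IsQuasiGeometricRoughPath γ T X)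
    (hXx : ∀ i : Fin d, ∀ s ∈ Set.Icc 0 T, ∀ t ∈ Set.Icc 0 T,
      X s t (WordSpace.word [MultiIndexLetter.basis (one_le_roughLevel hγ) i]) = x t i - x s i)
    (φ : EuclideanSpace ℝ (Fin d) → ℝ) (hφ : IsCb (roughLevel γ + 1) φ) :
    (∀ k : MultiIndexLetter d (roughLevel γ),
      (MultiIndexLetter.gradedBracket d (roughLevel γ)).IsControlled γ T X
        (roughLevel γ + 1 - k.degree) (derivLift hγ x φ k)) ∧
    ∃ I : MultiIndexLetter d (roughLevel γ) → ℝ → ℝ,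
      (∀ k, ∀ t ∈ Set.Icc 0 T,
        (MultiIndexLetter.gradedBracket d (roughLevel γ)).HasGeomRoughIntegral γ X
          (derivLift hγ x φ k) k t (I k t)) ∧
      ∀ s ∈ Set.Icc 0 T, ∀ t ∈ Set.Icc 0 T,
        φ (x t) = φ (x s) +
          ∑ n ∈ Finset.Icc 1 (roughLevel γ),
            ∑ k : MultiIndexLetter d (roughLevel γ) with k.degree = n,
              (1 / (multiFactorial k.1 : ℝ)) * (I k t - I k s) := by
  have hdeg : ∀ k : MultiIndexLetter d (roughLevel γ),
      roughLevel γ - k.degree + k.degree = roughLevel γ := fun k => Nat.sub_add_cancel k.2.2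
  have hctrl := fun k => isControlled_derivLift hγ hx hX hXx hφ k (hdeg k)
  refine ⟨fun k => ?_, ?_⟩
  · have h := hctrl k
    rwa [← Nat.sub_add_comm (show k.degree ≤ roughLevel γ from k.2.2)] at h
  choose I hI using fun k => (hctrl k).exists_hasGeomRoughIntegral hγ.1 hT.le hX (hdeg k)
  refine ⟨I, hI, ?_⟩
  obtain ⟨C, hC, hTay⟩ := hφ.exists_taylor_bound_multiDeriv (k := 0) (m := roughLevel γ + 1)
    (by simp)
  obtain ⟨D, hD, hH⟩ := hx.exists_norm_sub_le hγ.1.le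
  simp only [zero_add, multiDeriv_zero] at hTay
  have hgerm : ∀ s t, 0 ≤ s → s ≤ t → t ≤ T → |φ (x t) - φ (x s) -
      ∑ k : MultiIndexLetter d (roughLevel γ), 1 / (multiFactorial k.1 : ℝ) *
        (MultiIndexLetter.gradedBracket d (roughLevel γ)).integralGerm γ X (derivLift hγ x φ k) k s t| ≤
      C * D ^ (roughLevel γ + 1) * (t - s) ^ (((roughLevel γ + 1 : ℕ) : ℝ) * γ) := by
    intro s t h0 hst htT
    have hs : s ∈ Icc 0 T := ⟨h0, hst.trans htT⟩
    have ht : t ∈ Icc 0 T := ⟨h0.trans hst, htT⟩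
    rw [sum_integralGerm_derivLift hγ hX hXx hφ hs ht, multiDeriv_zero, sub_sub_sub_cancel_right]
    have h1 := hTay (x s) (x t - x s)
    rw [add_sub_cancel] at h1
    refine h1.trans ?_
    rw [mul_assoc]
    refine mul_le_mul_of_nonneg_left ?_ hC
    refine (pow_le_pow_left₀ (norm_nonneg _) (hH s hs t ht) _).trans_eq ?_
    rw [abs_of_nonneg (sub_nonneg.mpr hst), mul_pow, mul_comm ((roughLevel γ + 1 : ℕ) : ℝ) γ,
      Real.rpow_mul (sub_nonneg.mpr hst), Real.rpow_natCast]
  have hfromZero : ∀ t ∈ Icc 0 T, φ (x t) - φ (x 0) =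
      ∑ k : MultiIndexLetter d (roughLevel γ), 1 / (multiFactorial k.1 : ℝ) * I k t := by
    intro t ht
    have := IntervalPartition.meshToZero_neBot ht.1
    refine tendsto_nhds_unique (IntervalPartition.tendsto_sum_of_sub_le
      (F := fun t => φ (x t)) (one_lt_roughLevel_add_one_mul hγ.1) (by positivity) hgerm ht) ?_
    have hlim := tendsto_finsetSum Finset.univ
      fun k _ => (hI k t ht).const_mul (1 / (multiFactorial k.1 : ℝ))
    refine hlim.congr fun π => ?_
    simp only [IntervalPartition.sum, Finset.mul_sum]
    exact Finset.sum_comm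
  intro s hs t ht
  rw [Finset.sum_fiberwise_of_maps_to fun k _ => Finset.mem_Icc.mpr ⟨k.degree_pos, k.2.2⟩]
  simp only [mul_sub, Finset.sum_sub_distrib]
  rw [← hfromZero s hs, ← hfromZero t ht]
  ring
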